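/- **Gluings and their quantum graphs.** A gluing $\sigma$ of $n$ copies ("tiles") of a triangle with sides labelled $0,1,2$ consists of three involutions $\sigma_0,\sigma_1,\sigma_2$ (possibly with fixed points) of $\{0,\dots,n-1\}$: tile $i$ is glued along its side $s$ to side $s$ of tile $\sigma_s(i)$ by reflection in that side if $\sigma_s(i)\ne i$, and side $s$ of tile $i$ lies on the boundary if $\sigma_s(i)=i$. For $\ell_0,\ell_1,\ell_2>0$ let $G(\sigma,\ell)$ be the metric graph in which tile $i$ is replaced by a 3-star: a central vertex and three edges $(i,s)$, $s=0,1,2$, of length $\ell_s$, where the outer endpoints of $(i,s)$ and $(\sigma_s(i),s)$ are identified. On $\bigoplus_e L^2([0,l_e])$ let $\Delta$ be the operator $\phi\mapsto\phi''$ with Dirichlet standard boundary conditions: its domain consists of the $\phi$ such that on each edge $\phi_e,\phi_e'$ are absolutely continuous and $\phi_e''\in L^2$, $\phi$ is continuous at the vertices, $\phi=0$ at vertices of degree $1$, and at every other vertex the derivatives of $\phi$ directed into the vertex add up to $0$. Two such quantum graphs are isospectral if their Laplacians $\Delta$ have the same spectrum and every complex number has the same multiplicity as an eigenvalue of both; they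 are isometric if there is a distance-preserving bijection between the two metric spaces (with the path metric). **The Buser--Conway--Doyle--Semmler pairs.** There are seventeen pairs $(\sigma,\tau)$ of gluings, with $n=7,13,15,21$ tiles. Let $D_7=\{1,2,4\}$, $D_{13}=\{0,1,3,9\}$, $D_{15}=\{0,1,2,4,5,8,10\}$, $D_{21}=\{3,6,7,12,14\}$. The residues $i$ modulo $n$ are the points, and the sets $H_j=\{i: i+j\in D_n \bmod n\}$ the hyperplanes, of $PG(2,2)$, $PG(2,3)$, $PG(3,2)$, $PG(2,4)$ respectively. The involutions $\sigma_0;\sigma_1;\sigma_2$ are the collineations listed below (as products of transpositions of points), and $\tau_s$ is the action of $\sigma_s$ on hyperplanes, $\sigma_s(H_j)=H_{\tau_s(j)}$. - $7_{1}$: $(0\ 1)(2\ 5)$; $(0\ 2)(3\ 4)$; $(0\ 4)(1\ 6)$. - $7_{2}$: $(2\ 4)(5\ 6)$; $(1\ 2)(3\ 6)$; $(0\ 1)(4\ 6)$. - $7_{3}$: $(2\ 4)(5\ 6)$; $(1\ 2)(3\ 6)$; $(0\ 1)(2\ 5)$. - $13_{1}$: $(4\ 10)(5\ 11)(6\ 7)(8\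 12)$; $(2\ 4)(3\ 9)(5\ 8)(7\ 12)$; $(0\ 2)(1\ 5)(7\ 10)(9\ 11)$. - $13_{2}$: $(4\ 10)(5\ 11)(6\ 7)(8\ 12)$; $(2\ 4)(3\ 9)(5\ 8)(7\ 12)$; $(0\ 2)(1\ 6)(3\ 7)(4\ 11)$. - $13_{3}$: $(4\ 10)(5\ 11)(6\ 7)(8\ 12)$; $(2\ 4)(3\ 9)(5\ 8)(7\ 12)$; $(0\ 4)(1\ 8)(3\ 11)(10\ 12)$. - $13_{4}$: $(4\ 10)(5\ 11)(6\ 7)(8\ 12)$; $(2\ 4)(3\ 9)(5\ 8)(7\ 12)$; $(0\ 5)(1\ 11)(2\ 9)(8\ 10)$. - $13_{5}$: $(4\ 10)(5\ 11)(6\ 7)(8\ 12)$; $(2\ 4)(3\ 9)(5\ 8)(7\ 12)$; $(0\ 5)(1\ 12)(2\ 6)(3\ 10)$. - $13_{6}$: $(4\ 10)(5\ 11)(6\ 7)(8\ 12)$; $(2\ 4)(3\ 9)(5\ 8)(7\ 12)$; $(0\ 6)(1\ 7)(2\ 3)(4\ 8)$. - $13_{7}$: $(4\ 10)(5\ 11)(6\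 7)(8\ 12)$; $(2\ 4)(3\ 9)(5\ 8)(7\ 12)$; $(0\ 6)(1\ 12)(2\ 5)(4\ 9)$. - $13_{8}$: $(4\ 10)(5\ 11)(6\ 7)(8\ 12)$; $(2\ 4)(3\ 9)(5\ 8)(7\ 12)$; $(0\ 10)(1\ 8)(4\ 12)(7\ 9)$. - $13_{9}$: $(4\ 10)(5\ 11)(6\ 7)(8\ 12)$; $(1\ 2)(3\ 8)(6\ 11)(9\ 12)$; $(0\ 2)(1\ 5)(7\ 10)(9\ 11)$. - $15_{1}$: $(2\ 5)(3\ 7)(6\ 13)(8\ 10)(9\ 14)(11\ 12)$; $(1\ 2)(4\ 8)(6\ 9)(7\ 13)$; $(0\ 3)(2\ 13)(4\ 9)(5\ 12)$. - $15_{2}$: $(2\ 5)(3\ 7)(6\ 13)(8\ 10)(9\ 14)(11\ 12)$; $(1\ 2)(4\ 8)(6\ 9)(7\ 13)$; $(0\ 3)(1\ 7)(5\ 12)(6\ 8)$. - $15_{3}$: $(2\ 5)(3\ 7)(6\ 13)(8\ 10)(9\ 14)(11\ 12)$; $(1\ 2)(4\ 8)(6\ 9)(7\ 13)$; $(0\ 6)(1\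 12)(3\ 8)(5\ 7)$. - $15_{4}$: $(2\ 5)(3\ 7)(6\ 13)(8\ 10)(9\ 14)(11\ 12)$; $(1\ 6)(3\ 5)(4\ 13)(10\ 14)$; $(0\ 2)(4\ 5)(6\ 14)(7\ 11)$. - $21_{1}$: $(4\ 11)(5\ 14)(6\ 18)(7\ 19)(10\ 20)(12\ 15)(13\ 17)$; $(3\ 5)(4\ 17)(6\ 8)(7\ 9)(10\ 13)(11\ 20)(12\ 16)$; $(0\ 3)(1\ 10)(2\ 6)(7\ 15)(14\ 16)(17\ 19)(18\ 20)$. **Proposition.** Let $(\sigma,\tau)$ be one of these seventeen pairs, with $n$ tiles. There is an invertible $n\times n$ matrix $T$, depending only on the pair, with $T_{ji}=\pm1$ if $i\in H_j$ and $T_{ji}=0$ otherwise, and with $T M^\sigma_s=M^\tau_s T$ for $s=0,1,2$, where $M^\sigma_s$ is the matrix of the reflection rule $(M^\sigma_s f)_i=f_{\sigma_s(i)}$ if $\sigma_s(i)\neq i$ and $(M^\sigma_s f)_i=-f_i$ if $\sigma_s(i)=i$, such that for all lengths $\ell_0,\ell_1,\ell_2>0$: 1. for every $z\in\mathbb C$,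 the linear transplantation map $(\mathcal L\phi)_{(j,s)}=\sum_i T_{ji}\,\phi_{(i,s)}$, which acts on the restrictions of $\phi$ to the 3-stars, maps the $z$-eigenspace of $\Delta$ on $G(\sigma,\ell)$ bijectively onto the $z$-eigenspace of $\Delta$ on $G(\tau,\ell)$; 2. the quantum graphs $G(\sigma,\ell)$ and $G(\tau,\ell)$ are isospectral; 3. if $\ell_0,\ell_1,\ell_2$ are pairwise distinct, then $G(\sigma,\ell)$ and $G(\tau,\ell)$ are not isometric. -/

import Mathlib

open MeasureTheory Set
open scoped ENNReal NNReal

/-! ## Spectrum of an unbounded operator -/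

namespace LinearPMap

variable {H : Type*} [NormedAddCommGroup H] [InnerProductSpace ℂ H]

/-- The complex numbers `z` for which `z - A : dom A → H` has a bounded everywhere defined
two-sided inverse. -/
def unboundedResolventSet (A : H →ₗ.[ℂ] H) : Set ℂ :=
  {z | ∃ R : H →L[ℂ] H,
    (∀ h : H, ∃ x : A.domain, (x : H) = R h ∧ z • (x : H) - A x = h) ∧
    ∀ x : A.domain, R (z • (x : H) - A x) = x}

/-- The spectrum of an unbounded operator. -/
def unboundedSpectrum (A : H →ₗ.[ℂ] H) : Set ℂ := (unboundedResolventSet A)ᶜ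

/-- The eigenspace `{φ ∈ dom A | A φ = z φ}`. -/
def eigenspaceAt (A : H →ₗ.[ℂ] H) (z : ℂ) : Submodule ℂ H :=
  (LinearMap.ker (A.toFun - z • A.domain.subtype)).map A.domain.subtype

end LinearPMap

/-! ## Metric graphs and quantum graphs -/

/-- A finite metric graph without loops.  Every edge `e` is oriented from `src e` to `tgt e` and is
identified with the interval `[0, len e]`, the point `0` being `src e` and `len e` being `tgt e`. -/
structure MetricGraph where
  V : Type
  E : Type
  finiteV : Finite V
  fintypeE : Fintype E
  src : E → V
  tgt : E → V
  src_ne_tgt : ∀ e, src e ≠ tgt e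
  len : E → ℝ
  len_pos : ∀ e, 0 < len e

namespace MetricGraph

attribute [instance] MetricGraph.finiteV MetricGraph.fintypeE

variable (G : MetricGraph)

/-- The number of edges incident to a vertex. -/
noncomputable def degree (v : G.V) : ℕ := Set.ncard {e : G.E | G.src e = v ∨ G.tgt e = v}

/-! ### The metric space underlying a metric graph -/

/-- Points on the closed edges; different points may represent the same vertex. -/
def EdgePoint : Type := Σ e : G.E, Icc (0 : ℝ) (G.len e)

variable {G} in
/-- The point `p` of a closed edge is the endpoint of that edge at the vertex `v`. -/
def EdgePoint.IsAt (p : G.EdgePoint) (v : G.V) : Prop :=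
  ((p.2 : ℝ) = 0 ∧ G.src p.1 = v) ∨ ((p.2 : ℝ) = G.len p.1 ∧ G.tgt p.1 = v)

/-- `G.Path p q r`: there is a path of length `r` from `p` to `q` which runs through finitely many
segments of edges, and passes from one edge to another at a common vertex. -/
inductive Path : G.EdgePoint → G.EdgePoint → ℝ≥0 → Prop
  | refl (p : G.EdgePoint) : Path p p 0
  | along {p : G.EdgePoint} {e : G.E} {x : Icc (0 : ℝ) (G.len e)} {r : ℝ≥0}
      (h : Path p ⟨e, x⟩ r) (y : Icc (0 : ℝ) (G.len e)) : Path p ⟨e, y⟩ (r + nndist x y)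
  | switch {p q q' : G.EdgePoint} {r : ℝ≥0} (h : Path p q r) (v : G.V)
      (hq : q.IsAt v) (hq' : q'.IsAt v) : Path p q' r

variable {G} in
theorem Path.trans {p q s : G.EdgePoint} {a b : ℝ≥0} (h : G.Path p q a) (h' : G.Path q s b) :
    G.Path p s (a + b) := by
  induction h' with
  | refl => simpa using h
  | along _ y ih => rw [← add_assoc]; exact ih.along y
  | switch _ v hq hq' ih => exact ih.switch v hq hq'

variable {G} in
theorem Path.symm {p q : G.EdgePoint} {a : ℝ≥0} (h : G.Path p q a) : G.Path q p a := by
  induction h with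
  | refl => exact .refl p
  | @along e x r h y ih =>
    have h1 : G.Path ⟨e, y⟩ ⟨e, x⟩ (0 + nndist y x) := (Path.refl _).along x
    have h2 := h1.trans ih
    rwa [zero_add, nndist_comm, add_comm] at h2
  | switch _ v hq hq' ih =>
    have h1 := ((Path.refl _).switch v hq' hq).trans ih
    rwa [zero_add] at h1

/-- The distance of two points is the infimum of the lengths of the paths joining them. -/
noncomputable instance : PseudoEMetricSpace G.EdgePoint where
  edist p q := ⨅ (r : ℝ≥0) (_ : G.Path p q r), (r : ℝ≥0∞)
  edist_self p := by
    refine le_antisymm ?_ bot_le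
    exact (iInf₂_le (0 : ℝ≥0) (Path.refl p)).trans (by simp)
  edist_comm p q := by
    refine le_antisymm ?_ ?_ <;>
    exact le_iInf₂ fun r h => iInf₂_le r h.symm
  edist_triangle p q s := by
    rw [ENNReal.iInf_add]
    refine le_iInf fun a => ?_
    rw [ENNReal.iInf_add]
    refine le_iInf fun ha => ?_
    rw [ENNReal.add_iInf]
    refine le_iInf fun b => ?_
    rw [ENNReal.add_iInf]
    refine le_iInf fun hb => ?_
    exact (iInf₂_le (a + b) (ha.trans hb)).trans (by simp)

/-- The metric space of the metric graph: points at distance `0` are identified, that is, the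
endpoints of edges which lie at the same vertex. -/
def Space : Type := SeparationQuotient G.EdgePoint

noncomputable instance : EMetricSpace G.Space :=
  inferInstanceAs (EMetricSpace (SeparationQuotient G.EdgePoint))

/-- Two metric graphs are isometric if there is a distance preserving bijection between them. -/
def Isometric (G₁ G₂ : MetricGraph) : Prop := Nonempty (G₁.Space ≃ᵢ G₂.Space)

/-! ### The Laplacian with Dirichlet standard boundary conditions -/

/-- The Hilbert space `L²([0, len e])`. -/
abbrev EdgeL2 (e : G.E) : Type := Lp ℂ 2 (volume.restrict (Icc (0 : ℝ) (G.len e)))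

/-- The Hilbert space `⊕ₑ L²([0, len e])`. -/
abbrev L2 : Type := PiLp 2 G.EdgeL2

/-- Dirichlet standard boundary conditions for a family `f` of functions on the edges, with
derivatives `f'`: continuity at the vertices, with the value `0` at vertices of degree `1`, and
the sum of the derivatives directed into the vertex is `0` at all other vertices. -/
structure IsDSBC (f f' : G.E → ℝ → ℂ) : Prop where
  continuous_dirichlet : ∃ u : G.V → ℂ,
    (∀ e, f e 0 = u (G.src e) ∧ f e (G.len e) = u (G.tgt e)) ∧ ∀ v, G.degree v = 1 → u v = 0
  kirchhoff : ∀ v, G.degree v ≠ 1 → open Classical in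
    ∑ e, ((if G.tgt e = v then f' e (G.len e) else 0) - (if G.src e = v then f' e 0 else 0)) = 0

/-- `f'' e` is the second derivative of `f e` on `[0, len e]`, where `f e` and its first derivative
`f' e` are absolutely continuous. -/
structure IsSecondDeriv (f f' f'' : G.E → ℝ → ℂ) : Prop where
  ac : ∀ e, AbsolutelyContinuousOnInterval (f e) 0 (G.len e)
  deriv : ∀ e, ∀ x ∈ Icc 0 (G.len e), HasDerivWithinAt (f e) (f' e x) (Icc 0 (G.len e)) x
  ac' : ∀ e, AbsolutelyContinuousOnInterval (f' e) 0 (G.len e)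
  deriv' : ∀ e, ∀ᵐ x ∂volume.restrict (Icc 0 (G.len e)), HasDerivAt (f' e) (f'' e x) x

/-- The graph `{(φ, φ'')}` of the Laplacian `φ ↦ φ''` with Dirichlet standard boundary
conditions. -/
def laplacianGraph : Submodule ℂ (G.L2 × G.L2) where
  carrier := {p | ∃ f f' f'' : G.E → ℝ → ℂ,
    (∀ e, p.1 e =ᵐ[volume.restrict (Icc 0 (G.len e))] f e) ∧
    (∀ e, p.2 e =ᵐ[volume.restrict (Icc 0 (G.len e))] f'' e) ∧
    G.IsSecondDeriv f f' f'' ∧ G.IsDSBC f f'}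
  zero_mem' := by
    refine ⟨0, 0, 0, fun e => ?_, fun e => ?_, ⟨fun e => ?_, fun e x hx => ?_, fun e => ?_,
      fun e => ?_⟩, ⟨0, by simp, by simp⟩, by simp⟩
    · exact Lp.coeFn_zero _ _ _
    · exact Lp.coeFn_zero _ _ _
    · exact (absolutelyContinuousOnInterval_iff _ _ _).2
        fun ε hε => ⟨1, one_pos, by simp [hε]⟩
    · exact hasDerivWithinAt_const x _ (0 : ℂ)
    · exact (absolutelyContinuousOnInterval_iff _ _ _).2
        fun ε hε => ⟨1, one_pos, by simp [hε]⟩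
    · exact Filter.Eventually.of_forall fun x => hasDerivAt_const x (0 : ℂ)
  add_mem' := by
    rintro p q ⟨f, f', f'', h1, h2, h3, ⟨u, hu, hu0⟩, h4⟩ ⟨g, g', g'', k1, k2, k3, ⟨w, hw, hw0⟩, k4⟩
    refine ⟨f + g, f' + g', f'' + g'', fun e => ?_, fun e => ?_, ⟨fun e => ?_, fun e x hx => ?_,
      fun e => ?_, fun e => ?_⟩, ⟨u + w, fun e => ?_, fun v hv => ?_⟩, fun v hv => ?_⟩
    · exact (Lp.coeFn_add _ _).trans ((h1 e).add (k1 e))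
    · exact (Lp.coeFn_add _ _).trans ((h2 e).add (k2 e))
    · exact (h3.ac e).add (k3.ac e)
    · exact (h3.deriv e x hx).add (k3.deriv e x hx)
    · exact (h3.ac' e).add (k3.ac' e)
    · filter_upwards [h3.deriv' e, k3.deriv' e] with x hx hy using hx.add hy
    · simp [hu e, hw e]
    · simp [hu0 v hv, hw0 v hv]
    · have := congrArg₂ (· + ·) (h4 v hv) (k4 v hv)
      simp only [← Finset.sum_add_distrib, add_zero] at this
      refine (Finset.sum_congr rfl fun e _ => ?_).trans this
      simp only [Pi.add_apply]
      split_ifs <;> ring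
  smul_mem' := by
    rintro c p ⟨f, f', f'', h1, h2, h3, ⟨u, hu, hu0⟩, h4⟩
    refine ⟨c • f, c • f', c • f'', fun e => ?_, fun e => ?_, ⟨fun e => ?_, fun e x hx => ?_,
      fun e => ?_, fun e => ?_⟩, ⟨c • u, fun e => ?_, fun v hv => ?_⟩, fun v hv => ?_⟩
    · exact (Lp.coeFn_smul c _).trans ((h1 e).const_smul c)
    · exact (Lp.coeFn_smul c _).trans ((h2 e).const_smul c)
    · exact (h3.ac e).const_smul c
    · exact (h3.deriv e x hx).const_smul c
    · exact (h3.ac' e).const_smul c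
    · filter_upwards [h3.deriv' e] with x hx using hx.const_smul c
    · simp [hu e]
    · simp [hu0 v hv]
    · have := congrArg (c * ·) (h4 v hv)
      simp only [Finset.mul_sum, mul_zero] at this
      refine (Finset.sum_congr rfl fun e _ => ?_).trans this
      simp only [Pi.smul_apply, smul_eq_mul]
      split_ifs <;> ring

/-- The second derivative of an element of the domain is determined by that element. -/
theorem laplacianGraph_functional (p : G.L2 × G.L2) (hp : p ∈ G.laplacianGraph) (h0 : p.1 = 0) :
    p.2 = 0 := by
  obtain ⟨f, f', f'', h1, h2, h3, -⟩ := hp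
  have hf : ∀ e, ∀ x ∈ Icc 0 (G.len e), f e x = 0 := by
    intro e
    have hc : ContinuousOn (f e) (Icc 0 (G.len e)) := fun x hx => (h3.deriv e x hx).continuousWithinAt
    have hae : f e =ᵐ[volume.restrict (Icc 0 (G.len e))] fun _ => 0 := by
      have := h1 e
      rw [h0] at this
      exact this.symm.trans (Lp.coeFn_zero _ _ _)
    exact Measure.eqOn_Icc_of_ae_eq volume (G.len_pos e).ne hae hc continuousOn_const
  have hf' : ∀ e, ∀ x ∈ Icc 0 (G.len e), f' e x = 0 := by
    intro e x hx
    have h := h3.deriv e x hx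
    have k : HasDerivWithinAt (f e) 0 (Icc 0 (G.len e)) x :=
      (hasDerivWithinAt_const x _ (0 : ℂ)).congr (hf e) (hf e x hx)
    exact (uniqueDiffOn_Icc (G.len_pos e) x hx).eq_deriv _ h k
  ext e : 1
  refine Lp.ext (((h2 e).trans ?_).trans (Lp.coeFn_zero _ _ _).symm)
  rw [Measure.restrict_congr_set Ioo_ae_eq_Icc.symm]
  have h4 := h3.deriv' e
  rw [Measure.restrict_congr_set Ioo_ae_eq_Icc.symm] at h4
  filter_upwards [h4, ae_restrict_mem measurableSet_Ioo] with x hx hxm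
  have k : HasDerivAt (f' e) 0 x := by
    refine (hasDerivAt_const x (0 : ℂ)).congr_of_eventuallyEq ?_
    filter_upwards [Ioo_mem_nhds hxm.1 hxm.2] with y hy using hf' e y (Ioo_subset_Icc_self hy)
  exact hx.unique k

/-- The Laplacian `φ ↦ φ''` of the quantum graph, an unbounded operator whose domain is given by
the Dirichlet standard boundary conditions. -/
noncomputable def laplacian : G.L2 →ₗ.[ℂ] G.L2 := G.laplacianGraph.toLinearPMap

theorem laplacian_graph : G.laplacian.graph = G.laplacianGraph :=
  Submodule.toLinearPMap_graph_eq _ G.laplacianGraph_functional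

/-- Equality of the spectra, with multiplicities. -/
def Isospectral (G₁ G₂ : MetricGraph) : Prop :=
  G₁.laplacian.unboundedSpectrum = G₂.laplacian.unboundedSpectrum ∧
  ∀ z : ℂ, Module.rank ℂ (G₁.laplacian.eigenspaceAt z) =
    Module.rank ℂ (G₂.laplacian.eigenspaceAt z)

end MetricGraph

/-! ## Triangle gluings and their quantum graph analogs -/

/-- A gluing of `n` copies of a triangle whose sides are labelled by `0, 1, 2`: tile `i` is glued
along its side `s` to side `s` of the tile `nbr s i`, the two being mirror images in that side; if
`nbr s i = i` then side `s` of tile `i` lies on the boundary. -/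
structure Gluing (n : ℕ) where
  nbr : Fin 3 → Fin n → Fin n
  invol : ∀ s i, nbr s (nbr s i) = i

namespace Gluing

variable {n : ℕ} (σ : Gluing n)

/-- Two sides of tiles are glued, or equal. -/
def sideSetoid : Setoid (Fin n × Fin 3) where
  r a b := a.2 = b.2 ∧ (a.1 = b.1 ∨ σ.nbr a.2 a.1 = b.1)
  iseqv := by
    refine ⟨fun a => ⟨rfl, .inl rfl⟩, ?_, ?_⟩
    · rintro ⟨i, s⟩ ⟨j, t⟩ ⟨h, h'⟩
      dsimp only at h h' ⊢
      subst h
      rcases h' with rfl | rfl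
      · exact ⟨rfl, .inl rfl⟩
      · exact ⟨rfl, .inr (σ.invol _ _)⟩
    · rintro ⟨i, s⟩ ⟨j, t⟩ ⟨k, u⟩ ⟨h, h'⟩ ⟨g, g'⟩
      dsimp only at h h' g g' ⊢
      subst h g
      rcases h' with rfl | rfl <;> rcases g' with rfl | rfl
      · exact ⟨rfl, .inl rfl⟩
      · exact ⟨rfl, .inr rfl⟩
      · exact ⟨rfl, .inr rfl⟩
      · exact ⟨rfl, .inl (σ.invol _ _).symm⟩

/-- The metric graph obtained from a gluing by replacing each tile `i` with a 3-star: a central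
vertex, and for every side `s` an edge `(i, s)` of length `ℓ s` from the central vertex to an outer
vertex.  The outer vertices of two edges are joined if the corresponding sides are glued. -/
def starGraph (ℓ : Fin 3 → ℝ) (hℓ : ∀ s, 0 < ℓ s) : MetricGraph where
  V := Fin n ⊕ Quotient σ.sideSetoid
  E := Fin n × Fin 3
  finiteV := inferInstance
  fintypeE := inferInstance
  src e := .inl e.1
  tgt e := .inr ⟦e⟧
  src_ne_tgt _ := Sum.inl_ne_inr
  len e := ℓ e.2
  len_pos e := hℓ e.2

/-- The reflection rule for side `s`: a function given by its restrictions `f i` to the tiles, which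
vanishes on the boundary, continues from tile `i` across side `s` as `f (nbr s i)`, and as `- f i` if
this side lies on the boundary. -/
def continuation (s : Fin 3) : Matrix (Fin n) (Fin n) ℂ :=
  Matrix.of fun i j =>
    if σ.nbr s i = i then (if j = i then -1 else 0) else (if j = σ.nbr s i then 1 else 0)

/-- The linear map defined by a matrix on families of functions on 3-stars: the restriction of the
image of `φ` to the 3-star `j` is `∑ i, T j i • φ i` where `φ i` is the restriction of `φ` to the
3-star `i`. -/
noncomputable def transplant (σ τ : Gluing n) (T : Matrix (Fin n) (Fin n) ℂ) (ℓ : Fin 3 → ℝ)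
    (hℓ : ∀ s, 0 < ℓ s) : (σ.starGraph ℓ hℓ).L2 →ₗ[ℂ] (τ.starGraph ℓ hℓ).L2 where
  toFun φ := WithLp.toLp 2 fun e : Fin n × Fin 3 =>
    ∑ i, T e.1 i • (φ (i, e.2) : Lp ℂ 2 (volume.restrict (Icc (0 : ℝ) (ℓ e.2))))
  map_add' φ ψ := by
    ext e : 1
    let F (i : Fin n) : Lp ℂ 2 (volume.restrict (Icc (0 : ℝ) (ℓ e.2))) := φ (i, e.2)
    let F' (i : Fin n) : Lp ℂ 2 (volume.restrict (Icc (0 : ℝ) (ℓ e.2))) := ψ (i, e.2)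
    change ∑ i, T e.1 i • (F i + F' i) = ∑ i, T e.1 i • F i + ∑ i, T e.1 i • F' i
    simp only [smul_add, Finset.sum_add_distrib]
  map_smul' c φ := by
    ext e : 1
    let F (i : Fin n) : Lp ℂ 2 (volume.restrict (Icc (0 : ℝ) (ℓ e.2))) := φ (i, e.2)
    change ∑ i, T e.1 i • (c • F i) = c • ∑ i, T e.1 i • F i
    simp only [Finset.smul_sum, smul_comm c]

end Gluing

/-! ## The pairs of Buser, Conway, Doyle and Semmler -/

/-- A pair of gluings of `n` triangles, with the difference set modulo `n` which describes the
incidence of points and hyperplanes in the projective space that belongs to the pair: the tiles of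
`left` correspond to points, those of `right` to hyperplanes, and the point `i` lies on the hyperplane
`j` if and only if `j + i ∈ blockSet`. -/
structure TilePair where
  n : ℕ
  blockSet : Finset (Fin n)
  left : Gluing n
  right : Gluing n

/-- A transplantation matrix of a pair: it is invertible, turns the reflection rules of `left` into
those of `right`, and puts on tile `j` a signed sum of the functions on the tiles `i` incident
to `j`. -/
structure TilePair.IsTransplantation (P : TilePair) (T : Matrix (Fin P.n) (Fin P.n) ℂ) : Prop where
  isUnit : IsUnit T
  intertwines : ∀ s, T * P.left.continuation s = P.right.continuation s * T
  entry_eq : ∀ j i, (j + i ∈ P.blockSet → T j i = 1 ∨ T j i = -1) ∧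
    (j + i ∉ P.blockSet → T j i = 0)

/-- The maps that exchange, for each `s`, the two members of every pair in the list `p s`. -/
def pairing {n : ℕ} (p : Fin 3 → List (Fin n × Fin n)) (s : Fin 3) (i : Fin n) : Fin n :=
  (p s).foldr (fun q j => if i = q.1 then q.2 else if i = q.2 then q.1 else j) i

/-! The pairs with `7`, `13`, `15` and `21` triangles, in this order.  The lists give the pairs of
tiles glued along their sides labelled `0`, `1` and `2`.  The order of the pairs of equal size, and
the order of the labels, are immaterial. -/

def pair7_1 : TilePair where
  n := 7
  blockSet := {1, 2, 4}
  left := ⟨pairing ![[(0, 1), (2, 5)],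
      [(0, 2), (3, 4)],
      [(0, 4), (1, 6)]], by decide⟩
  right := ⟨pairing ![[(0, 4), (2, 3)],
      [(0, 1), (4, 6)],
      [(0, 2), (1, 5)]], by decide⟩

def pair7_2 : TilePair where
  n := 7
  blockSet := {1, 2, 4}
  left := ⟨pairing ![[(2, 4), (5, 6)],
      [(1, 2), (3, 6)],
      [(0, 1), (4, 6)]], by decide⟩
  right := ⟨pairing ![[(2, 4), (5, 6)],
      [(1, 2), (3, 6)],
      [(0, 2), (3, 4)]], by decide⟩

def pair7_3 : TilePair where
  n := 7
  blockSet := {1, 2, 4}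
  left := ⟨pairing ![[(2, 4), (5, 6)],
      [(1, 2), (3, 6)],
      [(0, 1), (2, 5)]], by decide⟩
  right := ⟨pairing ![[(2, 4), (5, 6)],
      [(1, 2), (3, 6)],
      [(0, 4), (2, 3)]], by decide⟩

def pair13_1 : TilePair where
  n := 13
  blockSet := {0, 1, 3, 9}
  left := ⟨pairing ![[(4, 10), (5, 11), (6, 7), (8, 12)],
      [(2, 4), (3, 9), (5, 8), (7, 12)],
      [(0, 2), (1, 5), (7, 10), (9, 11)]], by decide⟩
  right := ⟨pairing ![[(2, 8), (3, 9), (4, 5), (6, 10)],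
      [(1, 9), (4, 6), (5, 11), (7, 10)],
      [(0, 11), (2, 4), (3, 7), (9, 12)]], by decide⟩

def pair13_2 : TilePair where
  n := 13
  blockSet := {0, 1, 3, 9}
  left := ⟨pairing ![[(4, 10), (5, 11), (6, 7), (8, 12)],
      [(2, 4), (3, 9), (5, 8), (7, 12)],
      [(0, 2), (1, 6), (3, 7), (4, 11)]], by decide⟩
  right := ⟨pairing ![[(2, 8), (3, 9), (4, 5), (6, 10)],
      [(1, 9), (4, 6), (5, 11), (7, 10)],
      [(0, 7), (2, 10), (3, 12), (9, 11)]], by decide⟩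

def pair13_3 : TilePair where
  n := 13
  blockSet := {0, 1, 3, 9}
  left := ⟨pairing ![[(4, 10), (5, 11), (6, 7), (8, 12)],
      [(2, 4), (3, 9), (5, 8), (7, 12)],
      [(0, 4), (1, 8), (3, 11), (10, 12)]], by decide⟩
  right := ⟨pairing ![[(2, 8), (3, 9), (4, 5), (6, 10)],
      [(1, 9), (4, 6), (5, 11), (7, 10)],
      [(0, 5), (1, 12), (2, 6), (3, 10)]], by decide⟩

def pair13_4 : TilePair where
  n := 13
  blockSet := {0, 1, 3, 9}
  left := ⟨pairing ![[(4, 10), (5, 11), (6, 7), (8, 12)],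
      [(2, 4), (3, 9), (5, 8), (7, 12)],
      [(0, 5), (1, 11), (2, 9), (8, 10)]], by decide⟩
  right := ⟨pairing ![[(2, 8), (3, 9), (4, 5), (6, 10)],
      [(1, 9), (4, 6), (5, 11), (7, 10)],
      [(0, 11), (1, 4), (3, 8), (5, 12)]], by decide⟩

def pair13_5 : TilePair where
  n := 13
  blockSet := {0, 1, 3, 9}
  left := ⟨pairing ![[(4, 10), (5, 11), (6, 7), (8, 12)],
      [(2, 4), (3, 9), (5, 8), (7, 12)],
      [(0, 5), (1, 12), (2, 6), (3, 10)]], by decide⟩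
  right := ⟨pairing ![[(2, 8), (3, 9), (4, 5), (6, 10)],
      [(1, 9), (4, 6), (5, 11), (7, 10)],
      [(0, 4), (1, 8), (3, 11), (10, 12)]], by decide⟩

def pair13_6 : TilePair where
  n := 13
  blockSet := {0, 1, 3, 9}
  left := ⟨pairing ![[(4, 10), (5, 11), (6, 7), (8, 12)],
      [(2, 4), (3, 9), (5, 8), (7, 12)],
      [(0, 6), (1, 7), (2, 3), (4, 8)]], by decide⟩
  right := ⟨pairing ![[(2, 8), (3, 9), (4, 5), (6, 10)],
      [(1, 9), (4, 6), (5, 11), (7, 10)],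
      [(0, 7), (1, 10), (6, 12), (8, 9)]], by decide⟩

def pair13_7 : TilePair where
  n := 13
  blockSet := {0, 1, 3, 9}
  left := ⟨pairing ![[(4, 10), (5, 11), (6, 7), (8, 12)],
      [(2, 4), (3, 9), (5, 8), (7, 12)],
      [(0, 6), (1, 12), (2, 5), (4, 9)]], by decide⟩
  right := ⟨pairing ![[(2, 8), (3, 9), (4, 5), (6, 10)],
      [(1, 9), (4, 6), (5, 11), (7, 10)],
      [(0, 10), (1, 8), (4, 12), (7, 9)]], by decide⟩

def pair13_8 : TilePair where
  n := 13
  blockSet := {0, 1, 3, 9}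
  left := ⟨pairing ![[(4, 10), (5, 11), (6, 7), (8, 12)],
      [(2, 4), (3, 9), (5, 8), (7, 12)],
      [(0, 10), (1, 8), (4, 12), (7, 9)]], by decide⟩
  right := ⟨pairing ![[(2, 8), (3, 9), (4, 5), (6, 10)],
      [(1, 9), (4, 6), (5, 11), (7, 10)],
      [(0, 6), (1, 12), (2, 5), (4, 9)]], by decide⟩

def pair13_9 : TilePair where
  n := 13
  blockSet := {0, 1, 3, 9}
  left := ⟨pairing ![[(4, 10), (5, 11), (6, 7), (8, 12)],
      [(1, 2), (3, 8), (6, 11), (9, 12)],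
      [(0, 2), (1, 5), (7, 10), (9, 11)]], by decide⟩
  right := ⟨pairing ![[(2, 8), (3, 9), (4, 5), (6, 10)],
      [(0, 1), (2, 7), (5, 10), (8, 11)],
      [(0, 11), (2, 4), (3, 7), (9, 12)]], by decide⟩

def pair15_1 : TilePair where
  n := 15
  blockSet := {0, 1, 2, 4, 5, 8, 10}
  left := ⟨pairing ![[(2, 5), (3, 7), (6, 13), (8, 10), (9, 14), (11, 12)],
      [(1, 2), (4, 8), (6, 9), (7, 13)],
      [(0, 3), (2, 13), (4, 9), (5, 12)]], by decide⟩
  right := ⟨pairing ![[(2, 10), (3, 14), (5, 8), (6, 11), (7, 9), (12, 13)],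
      [(1, 2), (4, 8), (6, 9), (7, 13)],
      [(0, 7), (4, 14), (8, 12), (10, 13)]], by decide⟩

def pair15_2 : TilePair where
  n := 15
  blockSet := {0, 1, 2, 4, 5, 8, 10}
  left := ⟨pairing ![[(2, 5), (3, 7), (6, 13), (8, 10), (9, 14), (11, 12)],
      [(1, 2), (4, 8), (6, 9), (7, 13)],
      [(0, 3), (1, 7), (5, 12), (6, 8)]], by decide⟩
  right := ⟨pairing ![[(2, 10), (3, 14), (5, 8), (6, 11), (7, 9), (12, 13)],
      [(1, 2), (4, 8), (6, 9), (7, 13)],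
      [(0, 13), (4, 12), (7, 10), (8, 14)]], by decide⟩

def pair15_3 : TilePair where
  n := 15
  blockSet := {0, 1, 2, 4, 5, 8, 10}
  left := ⟨pairing ![[(2, 5), (3, 7), (6, 13), (8, 10), (9, 14), (11, 12)],
      [(1, 2), (4, 8), (6, 9), (7, 13)],
      [(0, 6), (1, 12), (3, 8), (5, 7)]], by decide⟩
  right := ⟨pairing ![[(2, 10), (3, 14), (5, 8), (6, 11), (7, 9), (12, 13)],
      [(1, 2), (4, 8), (6, 9), (7, 13)],
      [(0, 13), (1, 11), (5, 9), (8, 14)]], by decide⟩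

def pair15_4 : TilePair where
  n := 15
  blockSet := {0, 1, 2, 4, 5, 8, 10}
  left := ⟨pairing ![[(2, 5), (3, 7), (6, 13), (8, 10), (9, 14), (11, 12)],
      [(1, 6), (3, 5), (4, 13), (10, 14)],
      [(0, 2), (4, 5), (6, 14), (7, 11)]], by decide⟩
  right := ⟨pairing ![[(2, 10), (3, 14), (5, 8), (6, 11), (7, 9), (12, 13)],
      [(0, 2), (1, 10), (3, 13), (7, 11)],
      [(1, 14), (3, 4), (5, 13), (6, 10)]], by decide⟩

def pair21_1 : TilePair where
  n := 21
  blockSet := {3, 6, 7, 12, 14}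
  left := ⟨pairing ![[(4, 11), (5, 14), (6, 18), (7, 19), (10, 20), (12, 15), (13, 17)],
      [(3, 5), (4, 17), (6, 8), (7, 9), (10, 13), (11, 20), (12, 16)],
      [(0, 3), (1, 10), (2, 6), (7, 15), (14, 16), (17, 19), (18, 20)]], by decide⟩
  right := ⟨pairing ![[(0, 9), (1, 10), (2, 13), (7, 14), (8, 17), (15, 18), (16, 20)],
      [(0, 19), (1, 4), (2, 11), (3, 7), (8, 16), (15, 17), (18, 20)],
      [(0, 12), (4, 6), (5, 18), (7, 9), (8, 10), (11, 14), (13, 17)]], by decide⟩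

/-- The seventeen families of pairs of planar domains. -/
def bcdsPairs : List TilePair :=
  [pair7_1, pair7_2, pair7_3,
    pair13_1, pair13_2, pair13_3, pair13_4, pair13_5, pair13_6, pair13_7, pair13_8, pair13_9,
    pair15_1, pair15_2, pair15_3, pair15_4,
    pair21_1]

/-! ## Intertwined unbounded operators -/

namespace LinearPMap

variable {H₁ H₂ : Type*} [NormedAddCommGroup H₁] [InnerProductSpace ℂ H₁]
  [NormedAddCommGroup H₂] [InnerProductSpace ℂ H₂]

/-! Transplantation. The conditions at a centre are the same linear relations on every tile, so they
survive any linear combination of tiles. The conditions at the outer vertices say that, for each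
side `s`, the vector of outer values is fixed by the reflection rule `M_s` and the vector of outer
derivatives is negated by it (`isDSBC_starGraph_iff`). A matrix `T` with `T M_s = M'_s T` therefore
carries one set of conditions to the other. If `T` is invertible, so does `T⁻¹` in the opposite
direction; hence transplantation is a bounded isomorphism that identifies the graphs of the two
Laplacians, and with them the spectra and the eigenspaces.

The matrix. A proper 2-colouring of the tiles, with signs `D = diag(±1)`, turns the reflection rule
into `M_s = -D P_s D`, where `P_s` is the permutation matrix of `σ_s`. With the incidence matrix `N`
of points and hyperplanes, `T = D' N D` intertwines the rules as soon as `N P_s = P'_s N`, that is,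
as soon as incidence is invariant under the involutions. The hyperplanes form a symmetric design, so
`Tᵀ T` is a nonzero multiple of the identity plus a nonnegative multiple of a rank one projection,
which makes `T` invertible.

Non-isometry. Centres of tiles are exactly the points with three points at every small distance, so
an isometry permutes them and preserves the distance to the centre along each edge. When the lengths
are distinct, edge lengths reveal the side labels, and the isometry induces a bijection of tiles
commuting with all gluing involutions (`exists_perm_of_isometric`). Such a bijection would preserve
the number of tiles fixed by two given words in the involutions, and for each pair some choice of
two words distinguishes the gluings. -/

theorem mem_eigenspaceAt_iff (A : H₁ →ₗ.[ℂ] H₁) (z : ℂ) (x : H₁) :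
    x ∈ A.eigenspaceAt z ↔ (x, z • x) ∈ A.graph := by
  rw [eigenspaceAt, Submodule.mem_map]
  constructor
  · rintro ⟨y, hy, rfl⟩
    rw [LinearPMap.mem_graph_iff]
    refine ⟨y, rfl, ?_⟩
    rw [LinearMap.mem_ker, LinearMap.sub_apply, sub_eq_zero] at hy
    exact hy
  · intro h
    obtain ⟨y, hy, hz⟩ := (LinearPMap.mem_graph_iff _).1 h
    refine ⟨y, ?_, hy⟩
    rw [LinearMap.mem_ker, LinearMap.sub_apply, sub_eq_zero]
    change A y = z • (y : H₁)
    rw [hz, hy]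

theorem mem_unboundedResolventSet_iff (A : H₁ →ₗ.[ℂ] H₁) (z : ℂ) :
    z ∈ A.unboundedResolventSet ↔ ∃ R : H₁ →L[ℂ] H₁,
      (∀ h, (R h, z • R h - h) ∈ A.graph) ∧ ∀ x y, (x, y) ∈ A.graph → R (z • x - y) = x := by
  refine exists_congr fun R => and_congr (forall_congr' fun h => ?_) ?_
  · rw [LinearPMap.mem_graph_iff]
    refine exists_congr fun x => and_congr_right fun hx => ?_
    rw [← hx]
    constructor <;> intro h'
    · rw [← h', sub_sub_cancel]
    · change A x = z • (x : H₁) - h at h'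
      rw [h', sub_sub_cancel]
  · constructor
    · intro h x y hxy
      obtain ⟨w, rfl, rfl⟩ := (LinearPMap.mem_graph_iff _).1 hxy
      exact h w
    · exact fun h x => h x (A x) (A.mem_graph x)

/-- If `R` is the resolvent of `A` at `z`, the conjugate `L R L⁻¹` is the resolvent of `B` there. -/
theorem unboundedResolventSet_subset_of_intertwines {A : H₁ →ₗ.[ℂ] H₁} {B : H₂ →ₗ.[ℂ] H₂}
    (L : H₁ ≃L[ℂ] H₂) (hL : ∀ x y, (x, y) ∈ A.graph ↔ (L x, L y) ∈ B.graph) :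
    A.unboundedResolventSet ⊆ B.unboundedResolventSet := by
  intro z hz
  rw [mem_unboundedResolventSet_iff] at hz ⊢
  obtain ⟨R, h1, h2⟩ := hz
  refine ⟨(L : H₁ →L[ℂ] H₂) ∘L R ∘L (L.symm : H₂ →L[ℂ] H₁), fun h => ?_, fun x y hxy => ?_⟩
  · simpa using (hL _ _).1 (h1 (L.symm h))
  · have := h2 (L.symm x) (L.symm y) ((hL _ _).2 (by simpa using hxy))
    simp [this]

theorem unboundedSpectrum_eq_of_intertwines {A : H₁ →ₗ.[ℂ] H₁} {B : H₂ →ₗ.[ℂ] H₂}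
    (L : H₁ ≃L[ℂ] H₂) (hL : ∀ x y, (x, y) ∈ A.graph ↔ (L x, L y) ∈ B.graph) :
    A.unboundedSpectrum = B.unboundedSpectrum := by
  refine congrArg compl ((unboundedResolventSet_subset_of_intertwines L hL).antisymm
    (unboundedResolventSet_subset_of_intertwines L.symm fun x y => ?_))
  simpa using (hL (L.symm x) (L.symm y)).symm

theorem map_eigenspaceAt_of_intertwines {A : H₁ →ₗ.[ℂ] H₁} {B : H₂ →ₗ.[ℂ] H₂}
    (L : H₁ ≃L[ℂ] H₂) (hL : ∀ x y, (x, y) ∈ A.graph ↔ (L x, L y) ∈ B.graph) (z : ℂ) :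
    (A.eigenspaceAt z).map (L.toLinearEquiv : H₁ →ₗ[ℂ] H₂) = B.eigenspaceAt z := by
  ext y
  rw [Submodule.mem_map_equiv, mem_eigenspaceAt_iff, mem_eigenspaceAt_iff, hL]
  change (L (L.symm y), L (z • L.symm y)) ∈ _ ↔ _
  simp

end LinearPMap

/-! ## The boundary conditions of a star graph in terms of the reflection rules -/

namespace Gluing

variable {n : ℕ} (σ : Gluing n) (ℓ : Fin 3 → ℝ) (hℓ : ∀ s, 0 < ℓ s)

theorem continuation_mulVec (s : Fin 3) (v : Fin n → ℂ) (i : Fin n) :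
    (σ.continuation s).mulVec v i = if σ.nbr s i = i then -v i else v (σ.nbr s i) := by
  simp only [Matrix.mulVec, dotProduct, continuation, Matrix.of_apply]
  split_ifs <;> simp

theorem side_eq_iff (a b : Fin n × Fin 3) :
    (⟦a⟧ : Quotient σ.sideSetoid) = ⟦b⟧ ↔ a.2 = b.2 ∧ (a.1 = b.1 ∨ σ.nbr a.2 a.1 = b.1) :=
  Quotient.eq

theorem degree_center (i : Fin n) : (σ.starGraph ℓ hℓ).degree (.inl i) = 3 := by
  have : {e : Fin n × Fin 3 | (Sum.inl e.1 : Fin n ⊕ Quotient σ.sideSetoid) = .inl i ∨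
      (Sum.inr ⟦e⟧ : Fin n ⊕ Quotient σ.sideSetoid) = .inl i} =
      ((({i} : Finset (Fin n)) ×ˢ Finset.univ : Finset (Fin n × Fin 3)) : Set (Fin n × Fin 3)) := by
    ext ⟨j, t⟩
    simp [eq_comm]
  change Set.ncard {e : Fin n × Fin 3 | (Sum.inl e.1 : Fin n ⊕ Quotient σ.sideSetoid) = .inl i ∨
      (Sum.inr ⟦e⟧ : Fin n ⊕ Quotient σ.sideSetoid) = .inl i} = 3
  rw [this, Set.ncard_coe_finset]
  simp

theorem degree_outer (i : Fin n) (s : Fin 3) :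
    (σ.starGraph ℓ hℓ).degree (.inr ⟦(i, s)⟧) = if σ.nbr s i = i then 1 else 2 := by
  have : {e : Fin n × Fin 3 | (Sum.inl e.1 : Fin n ⊕ Quotient σ.sideSetoid) = .inr ⟦(i, s)⟧ ∨
      (Sum.inr ⟦e⟧ : Fin n ⊕ Quotient σ.sideSetoid) = .inr ⟦(i, s)⟧} =
      (({(i, s), (σ.nbr s i, s)} : Finset (Fin n × Fin 3)) : Set (Fin n × Fin 3)) := by
    ext ⟨j, t⟩
    simp only [reduceCtorEq, false_or, Sum.inr.injEq, mem_ofPred_eq, Finset.coe_insert,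
      Finset.coe_singleton, mem_insert_iff, mem_singleton_iff, Prod.mk.injEq, side_eq_iff]
    constructor
    · rintro ⟨rfl, rfl | rfl⟩
      · simp
      · simp [σ.invol]
    · rintro (⟨rfl, rfl⟩ | ⟨rfl, rfl⟩)
      · simp
      · simp [σ.invol]
  change Set.ncard {e : Fin n × Fin 3 |
      (Sum.inl e.1 : Fin n ⊕ Quotient σ.sideSetoid) = .inr ⟦(i, s)⟧ ∨
      (Sum.inr ⟦e⟧ : Fin n ⊕ Quotient σ.sideSetoid) = .inr ⟦(i, s)⟧} = _
  rw [this, Set.ncard_coe_finset]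
  split_ifs with h
  · simp [h]
  · rw [Finset.card_pair]
    simpa [eq_comm] using h

/-- The boundary conditions on a star graph for functions given tile by tile. -/
structure IsStarBC (f f' : Fin n × Fin 3 → ℝ → ℂ) : Prop where
  center : ∀ i s t, f (i, s) 0 = f (i, t) 0
  center' : ∀ i, ∑ s, f' (i, s) 0 = 0
  outer : ∀ s, (σ.continuation s).mulVec (fun i => f (i, s) (ℓ s)) = fun i => f (i, s) (ℓ s)
  outer' : ∀ s, (σ.continuation s).mulVec (fun i => f' (i, s) (ℓ s)) = -fun i => f' (i, s) (ℓ s)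

theorem sum_derivative_center (f' : Fin n × Fin 3 → ℝ → ℂ) (i : Fin n) : open Classical in
    (∑ e : (σ.starGraph ℓ hℓ).E,
      ((if (σ.starGraph ℓ hℓ).tgt e = .inl i then f' e ((σ.starGraph ℓ hℓ).len e) else 0) -
        (if (σ.starGraph ℓ hℓ).src e = .inl i then f' e 0 else 0))) = -∑ s, f' (i, s) 0 := by
  classical
  refine (Finset.sum_congr rfl fun e _ => (?_ : _ =
    (fun e : Fin n × Fin 3 => -(if e.1 = i then f' e 0 else 0)) e)).trans ?_
  · have h : (σ.starGraph ℓ hℓ).tgt e ≠ .inl i := Sum.inr_ne_inl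
    rw [if_neg h, zero_sub, neg_inj]
    exact if_congr Sum.inl_injective.eq_iff rfl rfl
  · change ∑ e : Fin n × Fin 3, -(if e.1 = i then f' e 0 else 0) = _
    rw [Fintype.sum_prod_type, Finset.sum_eq_single i]
    · simp
    · intro j _ hj
      simp [hj]
    · simp

theorem sum_derivative_outer (f' : Fin n × Fin 3 → ℝ → ℂ) (i : Fin n) (s : Fin 3)
    (hi : σ.nbr s i ≠ i) : open Classical in
    (∑ e : (σ.starGraph ℓ hℓ).E,
      ((if (σ.starGraph ℓ hℓ).tgt e = .inr ⟦(i, s)⟧ then f' e ((σ.starGraph ℓ hℓ).len e) else 0) -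
        (if (σ.starGraph ℓ hℓ).src e = .inr ⟦(i, s)⟧ then f' e 0 else 0))) =
      f' (i, s) (ℓ s) + f' (σ.nbr s i, s) (ℓ s) := by
  classical
  have hne : ((i, s) : Fin n × Fin 3) ≠ (σ.nbr s i, s) := by simpa [eq_comm] using hi
  refine (Finset.sum_congr rfl fun e _ => (?_ : _ = (fun e : Fin n × Fin 3 =>
    if e ∈ ({(i, s), (σ.nbr s i, s)} : Finset (Fin n × Fin 3)) then f' e (ℓ e.2) else 0) e)).trans ?_
  · have h : (σ.starGraph ℓ hℓ).src e ≠ .inr ⟦(i, s)⟧ := Sum.inl_ne_inr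
    rw [if_neg h, sub_zero]
    refine if_congr (Sum.inr_injective.eq_iff.trans ?_) rfl rfl
    obtain ⟨j, t⟩ := e
    rw [side_eq_iff, Finset.mem_insert, Finset.mem_singleton, Prod.mk.injEq, Prod.mk.injEq]
    constructor
    · rintro ⟨rfl, rfl | rfl⟩
      · simp
      · simp [σ.invol]
    · rintro (⟨rfl, rfl⟩ | ⟨rfl, rfl⟩)
      · simp
      · simp [σ.invol]
  · change ∑ e : Fin n × Fin 3,
      (if e ∈ ({(i, s), (σ.nbr s i, s)} : Finset (Fin n × Fin 3)) then f' e (ℓ e.2) else 0) = _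
    rw [← Finset.sum_filter, Finset.filter_mem_eq_inter, Finset.univ_inter, Finset.sum_pair hne]

/-- Across a glued side, being fixed by the swap is continuity and being negated by it is the
Kirchhoff condition. On a boundary side the rule is multiplication by `-1`: being fixed forces the
Dirichlet value `0`, and being negated is vacuous, as it must be at a vertex of degree `1`. -/
theorem isDSBC_starGraph_iff (f f' : Fin n × Fin 3 → ℝ → ℂ) :
    (σ.starGraph ℓ hℓ).IsDSBC f f' ↔ σ.IsStarBC ℓ f f' := by
  constructor
  · rintro ⟨⟨u, hu, hu0⟩, hk⟩
    have hu1 (i : Fin n) (s : Fin 3) : f (i, s) 0 = u (.inl i) := (hu (i, s)).1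
    have hu2 (i : Fin n) (s : Fin 3) : f (i, s) (ℓ s) = u (.inr ⟦(i, s)⟧) := (hu (i, s)).2
    refine ⟨fun i s t => by rw [hu1, hu1], fun i => ?_, fun s => ?_, fun s => ?_⟩
    · have := hk (.inl i) (by rw [degree_center]; norm_num)
      exact neg_eq_zero.1 ((σ.sum_derivative_center ℓ hℓ f' i).symm.trans this)
    · ext i
      rw [continuation_mulVec]
      split_ifs with h
      · have := hu0 (.inr ⟦(i, s)⟧) ((σ.degree_outer ℓ hℓ i s).trans (if_pos h))
        rw [hu2]
        exact (neg_eq_zero.2 this).trans this.symm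
      · rw [hu2, hu2]
        congr 2
        rw [side_eq_iff]
        exact ⟨rfl, .inr (σ.invol _ _)⟩
    · ext i
      rw [continuation_mulVec]
      split_ifs with h
      · rfl
      · have := hk (.inr ⟦(i, s)⟧) (by rw [degree_outer, if_neg h]; norm_num)
        exact (neg_eq_of_add_eq_zero_right
          ((σ.sum_derivative_outer ℓ hℓ f' i s h).symm.trans this)).symm
  · rintro ⟨h1, h2, h3, h4⟩
    have key : ∀ a b : Fin n × Fin 3, σ.sideSetoid a b → f a (ℓ a.2) = f b (ℓ b.2) := by
      rintro ⟨i, s⟩ ⟨j, t⟩ ⟨h, h'⟩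
      dsimp only at h h' ⊢
      subst h
      rcases h' with rfl | rfl
      · rfl
      · have := congrFun (h3 s) i
        rw [continuation_mulVec] at this
        split_ifs at this with h
        · rw [h]
        · exact this.symm
    refine ⟨⟨Sum.elim (fun i => f (i, 0) 0) (Quotient.lift (fun a => f a (ℓ a.2)) key),
      fun e => ⟨h1 _ _ _, rfl⟩, ?_⟩, ?_⟩
    · rintro (i | v) hv
      · rw [degree_center] at hv
        norm_num at hv
      · induction v using Quotient.inductionOn with | h a => ?_
        obtain ⟨i, s⟩ := a
        rw [degree_outer] at hv
        have h : σ.nbr s i = i := by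
          by_contra h
          rw [if_neg h] at hv
          norm_num at hv
        have := congrFun (h3 s) i
        rw [continuation_mulVec, if_pos h] at this
        exact self_eq_neg.1 this.symm
    · rintro (i | v) hv
      · refine (σ.sum_derivative_center ℓ hℓ f' i).trans ?_
        rw [h2, neg_zero]
      · induction v using Quotient.inductionOn with | h a => ?_
        obtain ⟨i, s⟩ := a
        have h : σ.nbr s i ≠ i := fun h => hv (by rw [degree_outer, if_pos h])
        refine (σ.sum_derivative_outer ℓ hℓ f' i s h).trans ?_
        have := congrFun (h4 s) i
        rw [continuation_mulVec, if_neg h] at this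
        rw [this]
        simp

end Gluing

/-! ## Transplantation -/

theorem AbsolutelyContinuousOnInterval.fun_sum_const_mul {ι : Type*} (t : Finset ι) {a b : ℝ}
    (c : ι → ℂ) (f : ι → ℝ → ℂ) (hf : ∀ i, AbsolutelyContinuousOnInterval (f i) a b) :
    AbsolutelyContinuousOnInterval (fun x => ∑ i ∈ t, c i * f i x) a b := by
  classical
  induction t using Finset.induction_on with
  | empty =>
    simpa using (absolutelyContinuousOnInterval_iff _ _ _).2
      fun ε hε => ⟨1, one_pos, by simp [hε]⟩
  | insert i t hi ih =>
    simp only [Finset.sum_insert hi]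
    exact ((hf i).const_smul (c i)).add ih

namespace Gluing

variable {n : ℕ} {σ τ : Gluing n} {T : Matrix (Fin n) (Fin n) ℂ} {ℓ : Fin 3 → ℝ}
  {hℓ : ∀ s, 0 < ℓ s}

/-- Transplantation of families of functions on the edges of 3-stars. -/
def transplantFun (T : Matrix (Fin n) (Fin n) ℂ) (f : Fin n × Fin 3 → ℝ → ℂ) :
    Fin n × Fin 3 → ℝ → ℂ := fun e x => ∑ i, T e.1 i * f (i, e.2) x

theorem transplant_ae_eq (φ : (σ.starGraph ℓ hℓ).L2) (f : Fin n × Fin 3 → ℝ → ℂ)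
    (h : ∀ e : (σ.starGraph ℓ hℓ).E,
      φ e =ᵐ[volume.restrict (Icc 0 ((σ.starGraph ℓ hℓ).len e))] f e)
    (e : (τ.starGraph ℓ hℓ).E) : transplant σ τ T ℓ hℓ φ e
      =ᵐ[volume.restrict (Icc 0 ((τ.starGraph ℓ hℓ).len e))] transplantFun T f e := by
  obtain ⟨j, s⟩ := e
  let F (i : Fin n) : Lp ℂ 2 (volume.restrict (Icc (0 : ℝ) (ℓ s))) := φ (i, s)
  have hF (i : Fin n) : F i =ᵐ[volume.restrict (Icc 0 (ℓ s))] f (i, s) := h (i, s)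
  change ⇑(∑ i, T j i • F i) =ᵐ[volume.restrict (Icc 0 (ℓ s))] fun x => ∑ i, T j i * f (i, s) x
  refine (Lp.coeFn_fun_finsetSum _ _).trans ?_
  have h2 : ∀ᵐ x ∂volume.restrict (Icc 0 (ℓ s)), ∀ i, (T j i • F i : Lp ℂ 2 _) x =
      T j i * f (i, s) x := by
    rw [ae_all_iff]
    intro i
    filter_upwards [Lp.coeFn_smul (T j i) (F i), hF i] with x hx hx'
    rw [hx, Pi.smul_apply, hx', smul_eq_mul]
  filter_upwards [h2] with x hx
  exact Finset.sum_congr rfl fun i _ => hx i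

/-- The outer conditions are eigenvector equations for the reflection rules with eigenvalues `1` and
`-1`, and an intertwining matrix maps eigenvectors to solutions of the same equations. -/
theorem IsStarBC.transplantFun {f f' : Fin n × Fin 3 → ℝ → ℂ} (h : σ.IsStarBC ℓ f f')
    (hT : ∀ s, T * σ.continuation s = τ.continuation s * T) :
    τ.IsStarBC ℓ (transplantFun T f) (transplantFun T f') where
  center j s t := Finset.sum_congr rfl fun i _ => by rw [h.center i s t]
  center' j := by
    change ∑ s, ∑ i, T j i * f' (i, s) 0 = 0
    rw [Finset.sum_comm]
    refine Finset.sum_eq_zero fun i _ => ?_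
    rw [← Finset.mul_sum, h.center', mul_zero]
  outer s := by
    have := congrArg T.mulVec (h.outer s)
    rwa [Matrix.mulVec_mulVec, hT, ← Matrix.mulVec_mulVec] at this
  outer' s := by
    have := congrArg T.mulVec (h.outer' s)
    rwa [Matrix.mulVec_mulVec, hT, ← Matrix.mulVec_mulVec, Matrix.mulVec_neg] at this

theorem transplant_mem_laplacianGraph (hT : ∀ s, T * σ.continuation s = τ.continuation s * T)
    {φ ψ : (σ.starGraph ℓ hℓ).L2} (h : (φ, ψ) ∈ (σ.starGraph ℓ hℓ).laplacianGraph) :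
    (transplant σ τ T ℓ hℓ φ, transplant σ τ T ℓ hℓ ψ) ∈ (τ.starGraph ℓ hℓ).laplacianGraph := by
  obtain ⟨f, f', f'', h1, h2, h3, h4⟩ := h
  refine ⟨transplantFun T f, transplantFun T f', transplantFun T f'', transplant_ae_eq _ f h1,
    transplant_ae_eq _ f'' h2, ⟨?_, ?_, ?_, ?_⟩, ?_⟩
  · rintro ⟨j, s⟩
    exact .fun_sum_const_mul _ _ _ fun i => h3.ac (i, s)
  · rintro ⟨j, s⟩ x hx
    exact HasDerivWithinAt.fun_sum fun i _ => (h3.deriv (i, s) x hx).const_mul _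
  · rintro ⟨j, s⟩
    exact .fun_sum_const_mul _ _ _ fun i => h3.ac' (i, s)
  · rintro ⟨j, s⟩
    have : ∀ᵐ x ∂volume.restrict (Icc 0 (ℓ s)), ∀ i,
        HasDerivAt (f' (i, s)) (f'' (i, s) x) x := by
      rw [ae_all_iff]
      exact fun i => h3.deriv' (i, s)
    change ∀ᵐ x ∂volume.restrict (Icc 0 (ℓ s)), _
    filter_upwards [this] with x hx
    exact HasDerivAt.fun_sum fun i _ => (hx i).const_mul _
  · exact (isDSBC_starGraph_iff _ _ _ _ _).2
      (((isDSBC_starGraph_iff _ _ _ _ _).1 h4).transplantFun hT)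

theorem continuous_transplant : Continuous (transplant σ τ T ℓ hℓ) := by
  refine (PiLp.continuous_toLp 2 _).comp (continuous_pi fun e => ?_)
  have h (i : Fin n) : Continuous fun φ : (σ.starGraph ℓ hℓ).L2 =>
      (φ (i, e.2) : Lp ℂ 2 (volume.restrict (Icc (0 : ℝ) (ℓ e.2)))) :=
    PiLp.continuous_apply 2 (σ.starGraph ℓ hℓ).EdgeL2 (i, e.2)
  exact continuous_finsetSum _ fun i _ => (h i).const_smul (T e.1 i)

theorem transplant_transplant {S : Matrix (Fin n) (Fin n) ℂ} (hST : S * T = 1)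
    (φ : (σ.starGraph ℓ hℓ).L2) :
    transplant τ σ S ℓ hℓ (transplant σ τ T ℓ hℓ φ) = φ := by
  ext ⟨k, s⟩ : 1
  let F (i : Fin n) : Lp ℂ 2 (volume.restrict (Icc (0 : ℝ) (ℓ s))) := φ (i, s)
  change ∑ j, S k j • ∑ i, T j i • F i = F k
  simp only [Finset.smul_sum, smul_smul]
  rw [Finset.sum_comm]
  simp only [← Finset.sum_smul, ← Matrix.mul_apply, hST]
  simp [Matrix.one_apply]

/-- Transplantation by an invertible matrix. -/
noncomputable def transplantEquiv (σ τ : Gluing n) (ℓ : Fin 3 → ℝ) (hℓ : ∀ s, 0 < ℓ s)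
    {S T : Matrix (Fin n) (Fin n) ℂ} (hST : S * T = 1) (hTS : T * S = 1) :
    (σ.starGraph ℓ hℓ).L2 ≃L[ℂ] (τ.starGraph ℓ hℓ).L2 where
  toLinearMap := transplant σ τ T ℓ hℓ
  invFun := transplant τ σ S ℓ hℓ
  left_inv := transplant_transplant hST
  right_inv := transplant_transplant hTS
  continuous_toFun := continuous_transplant
  continuous_invFun := continuous_transplant

theorem transplant_bijOn_and_isospectral (ℓ : Fin 3 → ℝ) (hℓ : ∀ s, 0 < ℓ s) (hu : IsUnit T)
    (hT : ∀ s, T * σ.continuation s = τ.continuation s * T) :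
    (∀ z : ℂ, Set.BijOn (transplant σ τ T ℓ hℓ) ((σ.starGraph ℓ hℓ).laplacian.eigenspaceAt z)
      ((τ.starGraph ℓ hℓ).laplacian.eigenspaceAt z)) ∧
    (σ.starGraph ℓ hℓ).Isospectral (τ.starGraph ℓ hℓ) := by
  obtain ⟨S, hTS, hST⟩ := isUnit_iff_exists.1 hu
  -- The inverse matrix intertwines in the opposite direction, which upgrades the inclusion of
  -- graphs to an equivalence.
  have hS : ∀ s, S * τ.continuation s = σ.continuation s * S := fun s => by
    calc S * τ.continuation s = S * (τ.continuation s * T) * S := by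
          rw [Matrix.mul_assoc, Matrix.mul_assoc, hTS, Matrix.mul_one]
      _ = σ.continuation s * S := by
          rw [← hT, ← Matrix.mul_assoc, hST, Matrix.one_mul]
  let L := transplantEquiv σ τ ℓ hℓ hST hTS
  have hL : ∀ x y, (x, y) ∈ (σ.starGraph ℓ hℓ).laplacian.graph ↔
      (L x, L y) ∈ (τ.starGraph ℓ hℓ).laplacian.graph := fun x y => by
    rw [MetricGraph.laplacian_graph, MetricGraph.laplacian_graph]
    refine ⟨transplant_mem_laplacianGraph hT, fun h => ?_⟩
    have : (L.symm (L x), L.symm (L y)) ∈ (σ.starGraph ℓ hℓ).laplacianGraph :=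
      transplant_mem_laplacianGraph hS h
    rwa [L.symm_apply_apply, L.symm_apply_apply] at this
  have hmap := LinearPMap.map_eigenspaceAt_of_intertwines L hL
  refine ⟨fun z => ?_, LinearPMap.unboundedSpectrum_eq_of_intertwines L hL, fun z => ?_⟩
  · rw [← hmap z, Submodule.map_coe]
    exact L.injective.injOn.bijOn_image
  · rw [← hmap z]
    exact (L.toLinearEquiv.submoduleMap _).rank_eq

end Gluing

/-! ## Lipschitz functions on metric graphs -/

namespace MetricGraph

variable (G : MetricGraph)

variable {G} in
theorem edist_along_le (e : G.E) (x y : Icc (0 : ℝ) (G.len e)) :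
    edist (α := G.EdgePoint) ⟨e, x⟩ ⟨e, y⟩ ≤ ENNReal.ofReal |(x : ℝ) - y| := by
  refine (iInf₂_le _ ((Path.refl (⟨e, x⟩ : G.EdgePoint)).along y)).trans ?_
  rw [zero_add, ← Real.dist_eq, ← edist_dist]
  exact (edist_nndist _ _).ge

variable {G} in
theorem edist_eq_zero_of_isAt {v : G.V} {p q : G.EdgePoint} (hp : p.IsAt v) (hq : q.IsAt v) :
    edist p q = 0 :=
  nonpos_iff_eq_zero.1 (iInf₂_le 0 ((Path.refl p).switch v hp hq))

variable {G} in
-- Along a path, `F` changes by at most the length of each segment and not at all at a switch. Test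
-- functions of this kind supply the lower bounds for distances, which are infima over paths.
theorem lipschitzWith_one_of_edges {F : G.EdgePoint → ℝ}
    (h : ∀ e x y, |F ⟨e, x⟩ - F ⟨e, y⟩| ≤ |(x : ℝ) - y|)
    (h' : ∀ (v : G.V) (p q : G.EdgePoint), p.IsAt v → q.IsAt v → F p = F q) :
    LipschitzWith 1 F := by
  intro p q
  rw [ENNReal.coe_one, one_mul]
  refine le_iInf₂ fun r hr => ?_
  induction hr with
  | refl => simp
  | @along e x r _ y ih =>
    refine (edist_triangle _ (F ⟨e, x⟩) _).trans ?_
    rw [ENNReal.coe_add]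
    refine add_le_add ih ?_
    rw [edist_dist, Real.dist_eq, ← edist_nndist, Subtype.edist_eq, edist_dist, Real.dist_eq]
    exact ENNReal.ofReal_le_ofReal (h e x y)
  | switch _ v hq hq' ih => rwa [← h' v _ _ hq hq']

end MetricGraph

theorem LipschitzWith.abs_sub_le_of_edist_le {X : Type*} [PseudoEMetricSpace X] {F : X → ℝ}
    (hF : LipschitzWith 1 F) {p q : X} {r : ℝ} (hr : 0 ≤ r) (h : edist p q ≤ ENNReal.ofReal r) :
    |F p - F q| ≤ r := by
  have := (hF p q).trans (by simpa using h)
  rwa [edist_dist, ENNReal.ofReal_le_ofReal_iff hr, Real.dist_eq] at this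

/-! ### Distances in star graphs -/

namespace Gluing

variable {n : ℕ} {σ : Gluing n} {ℓ : Fin 3 → ℝ} {hℓ : ∀ s, 0 < ℓ s}

/-- The points of the edges of a star graph. -/
abbrev StarPoint (σ : Gluing n) (ℓ : Fin 3 → ℝ) (hℓ : ∀ s, 0 < ℓ s) : Type :=
  (σ.starGraph ℓ hℓ).EdgePoint

namespace StarPoint

/-- The point at distance `x` from the center on the edge `(i, s)`. -/
def mk (i : Fin n) (s : Fin 3) (x : ℝ) (hx : x ∈ Icc 0 (ℓ s)) : StarPoint σ ℓ hℓ := ⟨(i, s), ⟨x, hx⟩⟩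

/-- The edge containing a point. -/
def edge (p : StarPoint σ ℓ hℓ) : Fin n × Fin 3 := p.1

/-- The position of a point on its edge. -/
def pos (p : StarPoint σ ℓ hℓ) : ℝ := p.2

theorem pos_mem (p : StarPoint σ ℓ hℓ) : pos p ∈ Icc 0 (ℓ (edge p).2) := p.2.2

theorem ext {p q : StarPoint σ ℓ hℓ} (h : edge p = edge q) (h' : pos p = pos q) : p = q := by
  obtain ⟨e, x⟩ := p
  obtain ⟨e', y⟩ := q
  obtain rfl : e = e' := h
  obtain rfl : x = y := Subtype.ext h'
  rfl

theorem edist_le {p q : StarPoint σ ℓ hℓ} (h : edge p = edge q) :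
    edist p q ≤ ENNReal.ofReal |pos p - pos q| := by
  obtain ⟨e, x⟩ := p
  obtain ⟨e', y⟩ := q
  obtain rfl : e = e' := h
  exact MetricGraph.edist_along_le e x y

theorem edist_center {p q : StarPoint σ ℓ hℓ} (hp : pos p = 0) (hq : pos q = 0)
    (h : (edge p).1 = (edge q).1) : edist p q = 0 :=
  MetricGraph.edist_eq_zero_of_isAt (G := σ.starGraph ℓ hℓ) (v := .inl (edge q).1)
    (.inl ⟨hp, congrArg Sum.inl h⟩)
    (.inl ⟨hq, rfl⟩)

theorem edist_outer {p q : StarPoint σ ℓ hℓ} (hp : pos p = ℓ (edge p).2)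
    (hq : pos q = ℓ (edge q).2) (h : σ.sideSetoid (edge p) (edge q)) : edist p q = 0 :=
  MetricGraph.edist_eq_zero_of_isAt (G := σ.starGraph ℓ hℓ) (v := .inr ⟦edge q⟧)
    (.inr ⟨hp, congrArg Sum.inr (Quotient.sound h)⟩) (.inr ⟨hq, rfl⟩)

theorem lipschitzWith_one {φ : Fin n → Fin 3 → ℝ → ℝ}
    (h : ∀ i s, ∀ x y : ℝ, |φ i s x - φ i s y| ≤ |x - y|)
    (h0 : ∀ i s t, φ i s 0 = φ i t 0)
    (h1 : ∀ i s, φ i s (ℓ s) = φ (σ.nbr s i) s (ℓ s)) :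
    LipschitzWith 1 fun p : StarPoint σ ℓ hℓ => φ (edge p).1 (edge p).2 (pos p) := by
  refine MetricGraph.lipschitzWith_one_of_edges (fun e x y => h _ _ _ _) ?_
  have key : ∀ a b : Fin n × Fin 3, σ.sideSetoid a b → φ a.1 a.2 (ℓ a.2) = φ b.1 b.2 (ℓ b.2) := by
    rintro ⟨i, s⟩ ⟨j, t⟩ ⟨h, h'⟩
    dsimp only at h h' ⊢
    subst h
    rcases h' with rfl | rfl
    · rfl
    · exact h1 _ _
  rintro v p q (⟨hp, rfl⟩ | ⟨hp, rfl⟩) (⟨hq, h'⟩ | ⟨hq, h'⟩)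
  · have hp : pos p = 0 := hp
    have hq : pos q = 0 := hq
    have h' : (edge q).1 = (edge p).1 := Sum.inl_injective h'
    rw [hp, hq, h']
    exact h0 _ _ _
  · exact absurd h' Sum.inr_ne_inl
  · exact absurd h' Sum.inl_ne_inr
  · have hp : pos p = ℓ (edge p).2 := hp
    have hq : pos q = ℓ (edge q).2 := hq
    rw [hp, hq]
    exact (key _ _ (Quotient.exact (Sum.inr_injective h'))).symm

theorem lipschitzWith_pos : LipschitzWith 1 (pos : StarPoint σ ℓ hℓ → ℝ) :=
  lipschitzWith_one (φ := fun _ _ x => x) (fun _ _ _ _ => le_rfl) (fun _ _ _ => rfl)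
    fun _ _ => rfl

-- This test function vanishes off the edge `a` and the edge glued to it, so leaving these edges
-- from a point costs at least its position.
open Classical in
theorem lipschitzWith_sidePos (a : Fin n × Fin 3) :
    LipschitzWith 1 fun p : StarPoint σ ℓ hℓ => if σ.sideSetoid a (edge p) then pos p else 0 := by
  refine lipschitzWith_one (φ := fun i s x => if σ.sideSetoid a (i, s) then x else 0)
    (fun i s x y => ?_) (fun i s t => ?_) (fun i s => ?_)
  · split_ifs <;> simp
  · simp
  · have h : σ.sideSetoid (i, s) (σ.nbr s i, s) := ⟨rfl, .inr rfl⟩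
    have : σ.sideSetoid a (i, s) ↔ σ.sideSetoid a (σ.nbr s i, s) :=
      ⟨fun k => Setoid.trans' _ k h, fun k => Setoid.trans' _ k (Setoid.symm' _ h)⟩
    simp only [this]

/-- The function is `0` at the point at position `a` on the edge `(i₀, s₀)` and has risen to `δ` at
all three outer ends of the tile; the bounds on `δ` ensure this, so it extends by the constant `δ`.
Leaving the tile from that point costs at least `δ`. -/
theorem lipschitzWith_plateau (i₀ : Fin n) (s₀ : Fin 3) {a δ : ℝ} (ha : 0 ≤ a)
    (haδ : a + δ ≤ ℓ s₀) (hδ' : ∀ t, δ ≤ ℓ t) :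
    LipschitzWith 1 fun p : StarPoint σ ℓ hℓ => if (edge p).1 = i₀ then
      (if (edge p).2 = s₀ then min (max (pos p - a) 0) δ else min (max (pos p) 0) δ) else δ := by
  have hlip (b x y : ℝ) : |min (max (x - b) 0) δ - min (max (y - b) 0) δ| ≤ |x - y| := by
    refine (abs_inf_sub_inf_le_abs _ _ _).trans ((abs_sup_sub_sup_le_abs _ _ _).trans ?_)
    rw [sub_sub_sub_cancel_right]
  refine lipschitzWith_one (φ := fun i s x => if i = i₀ then
    (if s = s₀ then min (max (x - a) 0) δ else min (max x 0) δ) else δ)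
    (fun i s x y => ?_) (fun i s t => ?_) (fun i s => ?_)
  · split_ifs
    · exact hlip a x y
    · simpa using hlip 0 x y
    · simp
  · have : max (0 - a) 0 = 0 := max_eq_right (by linarith)
    simp only [this, max_self, ite_self]
  · have h (i) : (if i = i₀ then (if s = s₀ then min (max (ℓ s - a) 0) δ else min (max (ℓ s) 0) δ)
        else δ) = δ := by
      split_ifs with h1 h2
      · subst h2
        exact min_eq_right (le_max_of_le_left (by linarith))
      · exact min_eq_right (le_max_of_le_left (hδ' s))
      · rfl
    exact (h i).trans (h _).symm

/-- The ball around a point with radius the distance to the center consists of points on the edge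
or on an edge glued to it. -/
theorem sideSetoid_of_edist_le {p q : StarPoint σ ℓ hℓ} {r : ℝ} (hr : 0 ≤ r) (hp : r < pos p)
    (h : edist p q ≤ ENNReal.ofReal r) : σ.sideSetoid (edge p) (edge q) := by
  have := (lipschitzWith_sidePos (edge p)).abs_sub_le_of_edist_le hr h
  by_contra hne
  rw [if_pos (Setoid.refl' _ _), if_neg hne, sub_zero] at this
  linarith [le_abs_self (pos p)]

/-- Points close to a point that is not an outer vertex belong to the same tile. -/
theorem exists_tile_eq (p : StarPoint σ ℓ hℓ) (hp : pos p < ℓ (edge p).2) :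
    ∃ δ > 0, ∀ r, 0 ≤ r → r < δ → ∀ q : StarPoint σ ℓ hℓ, edist p q ≤ ENNReal.ofReal r →
      (edge q).1 = (edge p).1 := by
  obtain ⟨δ, hδ, h1, h2⟩ : ∃ δ > 0, pos p + δ ≤ ℓ (edge p).2 ∧ ∀ t, δ ≤ ℓ t := by
    refine ⟨min (ℓ (edge p).2 - pos p) (min (ℓ 0) (min (ℓ 1) (ℓ 2))), ?_, ?_, ?_⟩
    · have := hℓ 0
      have := hℓ 1
      have := hℓ 2
      simp only [lt_min_iff]
      exact ⟨by linarith, by assumption, by assumption, by assumption⟩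
    · linarith [min_le_left (ℓ (edge p).2 - pos p) (min (ℓ 0) (min (ℓ 1) (ℓ 2)))]
    · intro t
      fin_cases t <;> simp
  refine ⟨δ, hδ, fun r hr hrδ q h => ?_⟩
  have := (lipschitzWith_plateau (edge p).1 (edge p).2 (pos_mem p).1 h1 h2).abs_sub_le_of_edist_le hr h
  by_contra hne
  simp only [if_pos, if_neg hne, sub_self, max_self] at this
  rw [min_eq_left hδ.le, zero_sub, abs_neg, abs_of_pos hδ] at this
  linarith

end StarPoint

end Gluing

/-! ## Isometries of star graphs -/

/-- The point `p` of a pseudometric space is a branch point if there are three points at every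
sufficiently small distance from `p`. -/
def IsBranchPoint {X : Type*} [PseudoEMetricSpace X] (p : X) : Prop :=
  ∃ r₀ > 0, ∀ r, 0 < r → r < r₀ → ∃ q : Fin 3 → X, (∀ a, edist p (q a) = ENNReal.ofReal r) ∧
    ∀ a b, a ≠ b → edist (q a) (q b) ≠ 0

theorem Isometry.isBranchPoint {X Y : Type*} [PseudoEMetricSpace X] [PseudoEMetricSpace Y]
    {g : X → Y} (hg : Isometry g) {p : X} (h : IsBranchPoint p) : IsBranchPoint (g p) := by
  obtain ⟨r₀, hr₀, h⟩ := h
  refine ⟨r₀, hr₀, fun r hr hr' => ?_⟩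
  obtain ⟨q, hq, hq'⟩ := h r hr hr'
  exact ⟨g ∘ q, fun a => by rw [Function.comp, hg, hq], fun a b hab => by
    rw [Function.comp, Function.comp, hg]; exact hq' a b hab⟩

/-- Pigeonhole: if a single yes/no property separates the points at distance `r`, there are at most
two of them. -/
theorem not_isBranchPoint {X : Type*} [PseudoEMetricSpace X] {p : X}
    (h : ∀ r₀ > 0, ∃ r, 0 < r ∧ r < r₀ ∧ ∃ P : X → Prop, ∀ q q', edist p q = ENNReal.ofReal r →
      edist p q' = ENNReal.ofReal r → (P q ↔ P q') → q = q') : ¬ IsBranchPoint p := by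
  rintro ⟨r₀, hr₀, h'⟩
  obtain ⟨r, hr, hr', P, hP⟩ := h r₀ hr₀
  obtain ⟨q, hq, hq'⟩ := h' r hr hr'
  obtain ⟨a, b, hab, hab'⟩ :=
    Fintype.exists_ne_map_eq_of_card_lt (fun a => P (q a)) (by simp)
  refine hq' a b hab ?_
  rw [hP _ _ (hq a) (hq b) (iff_of_eq hab'), edist_self]

/-- Isometries of two pseudometric spaces that are inverse to each other up to points at
distance `0`. -/
structure PseudoIsometryEquiv (X Y : Type*) [PseudoEMetricSpace X] [PseudoEMetricSpace Y] where
  toFun : X → Y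
  invFun : Y → X
  isometry_toFun : Isometry toFun
  isometry_invFun : Isometry invFun
  left_inv : ∀ p, edist (invFun (toFun p)) p = 0
  right_inv : ∀ q, edist (toFun (invFun q)) q = 0

/-- The inverse. -/
def PseudoIsometryEquiv.symm {X Y : Type*} [PseudoEMetricSpace X] [PseudoEMetricSpace Y]
    (e : PseudoIsometryEquiv X Y) : PseudoIsometryEquiv Y X :=
  ⟨e.invFun, e.toFun, e.isometry_invFun, e.isometry_toFun, e.right_inv, e.left_inv⟩

/-- Edges and positions belong to representatives, not to points of the quotient, so representatives
are chosen; the maps are then mutually inverse only up to distance `0`. -/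
theorem IsometryEquiv.exists_pseudoIsometryEquiv {X Y : Type*} [PseudoEMetricSpace X]
    [PseudoEMetricSpace Y] (f : SeparationQuotient X ≃ᵢ SeparationQuotient Y) :
    Nonempty (PseudoIsometryEquiv X Y) := by
  have hX := Function.surjInv_eq (SeparationQuotient.surjective_mk (X := X))
  have hY := Function.surjInv_eq (SeparationQuotient.surjective_mk (X := Y))
  refine ⟨⟨fun p => Function.surjInv SeparationQuotient.surjective_mk (f (.mk p)),
    fun q => Function.surjInv SeparationQuotient.surjective_mk (f.symm (.mk q)),
    fun p q => ?_, fun p q => ?_, fun p => ?_, fun q => ?_⟩⟩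
  · rw [← SeparationQuotient.edist_mk, hY, hY, f.edist_eq, SeparationQuotient.edist_mk]
  · rw [← SeparationQuotient.edist_mk, hX, hX, f.symm.edist_eq, SeparationQuotient.edist_mk]
  · rw [← SeparationQuotient.edist_mk, hX, hY, f.symm_apply_apply, edist_self]
  · rw [← SeparationQuotient.edist_mk, hY, hX, f.apply_symm_apply, edist_self]

/-! ### Recovering the gluing from the metric -/

namespace Gluing.StarPoint

variable {n : ℕ} {σ τ : Gluing n} {ℓ : Fin 3 → ℝ} {hℓ : ∀ s, 0 < ℓ s}

theorem pos_eq_of_edist_eq_zero {p q : StarPoint σ ℓ hℓ} (h : edist p q = 0) : pos p = pos q := by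
  have := lipschitzWith_pos.abs_sub_le_of_edist_le le_rfl (h.trans_le (by simp))
  exact sub_eq_zero.1 (abs_nonpos_iff.1 this)

theorem sideSetoid_of_edist_eq_zero {p q : StarPoint σ ℓ hℓ} (hp : 0 < pos p)
    (h : edist p q = 0) : σ.sideSetoid (edge p) (edge q) :=
  sideSetoid_of_edist_le le_rfl hp (h.trans_le (by simp))

/-- The center of a tile, as an endpoint of a given edge. -/
def center (i : Fin n) (s : Fin 3) : StarPoint σ ℓ hℓ := mk i s 0 ⟨le_rfl, (hℓ s).le⟩

/-- The outer endpoint of an edge. -/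
def outer (i : Fin n) (s : Fin 3) : StarPoint σ ℓ hℓ := mk i s (ℓ s) ⟨(hℓ s).le, le_rfl⟩

theorem edist_center_le (p : StarPoint σ ℓ hℓ) (t : Fin 3) :
    edist (center (edge p).1 t) p ≤ ENNReal.ofReal (pos p) := by
  have h1 : edist (center (edge p).1 t : StarPoint σ ℓ hℓ) (center (edge p).1 (edge p).2) = 0 :=
    edist_center rfl rfl rfl
  have h2 : edist (center (edge p).1 (edge p).2) p ≤ ENNReal.ofReal |0 - pos p| :=
    edist_le (p := center (edge p).1 (edge p).2) rfl
  rw [zero_sub, abs_neg, abs_of_nonneg (pos_mem p).1] at h2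
  exact (edist_triangle _ _ _).trans (by rwa [h1, zero_add])

theorem edist_outer_le {e : Fin n × Fin 3} (p : StarPoint σ ℓ hℓ) (h : σ.sideSetoid e (edge p)) :
    edist (outer e.1 e.2) p ≤ ENNReal.ofReal (ℓ e.2 - pos p) := by
  have h1 : edist (outer e.1 e.2 : StarPoint σ ℓ hℓ) (outer (edge p).1 (edge p).2) = 0 :=
    edist_outer rfl rfl h
  have h2 : edist (outer (edge p).1 (edge p).2) p ≤ ENNReal.ofReal |ℓ (edge p).2 - pos p| :=
    edist_le (p := outer (edge p).1 (edge p).2) rfl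
  rw [abs_of_nonneg (sub_nonneg.2 (pos_mem p).2)] at h2
  exact (edist_triangle _ _ _).trans (by rwa [h1, zero_add, h.1])

theorem isBranchPoint_of_pos_eq_zero {p : StarPoint σ ℓ hℓ} (hp : pos p = 0) :
    IsBranchPoint p := by
  refine ⟨min (ℓ 0) (min (ℓ 1) (ℓ 2)), by simp [hℓ], fun r hr hr' => ?_⟩
  have hrℓ : ∀ t, r < ℓ t := by
    rw [lt_min_iff, lt_min_iff] at hr'
    intro t
    fin_cases t
    · exact hr'.1
    · exact hr'.2.1
    · exact hr'.2.2
  let q (t : Fin 3) : StarPoint σ ℓ hℓ := mk (edge p).1 t r ⟨hr.le, (hrℓ t).le⟩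
  refine ⟨q, fun t => le_antisymm ?_ ?_, fun s t hst h => ?_⟩
  · have h1 : edist p (center (edge p).1 t) = 0 := edist_center hp rfl rfl
    refine (edist_triangle _ _ _).trans (?_ : edist p (center (edge p).1 t) + _ ≤ _)
    rw [h1, zero_add]
    exact edist_center_le (q t) t
  · have := lipschitzWith_pos p (q t)
    rw [ENNReal.coe_one, one_mul, hp, edist_dist, Real.dist_eq] at this
    change ENNReal.ofReal |0 - r| ≤ _ at this
    rwa [zero_sub, abs_neg, abs_of_pos hr] at this
  · exact hst (sideSetoid_of_edist_eq_zero (p := q s) hr h).1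

/-- In the interior of an edge, the points at a small distance differ in being further out or
further in. At an outer vertex they lie on the given edge or on the one glued to it, and the tile
tells them apart. -/
theorem isBranchPoint_iff {p : StarPoint σ ℓ hℓ} : IsBranchPoint p ↔ pos p = 0 := by
  refine ⟨fun h => ?_, isBranchPoint_of_pos_eq_zero⟩
  contrapose! h
  have hp : 0 < pos p := (pos_mem p).1.lt_of_ne' h
  refine not_isBranchPoint fun r₀ hr₀ => ?_
  rcases (pos_mem p).2.lt_or_eq with hlt | heq
  · obtain ⟨δ, hδ, hδ'⟩ := exists_tile_eq p hlt
    obtain ⟨r, hr, hr'⟩ := exists_between (lt_min hr₀ (lt_min hδ hp))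
    rw [lt_min_iff, lt_min_iff] at hr'
    have key : ∀ q, edist p q = ENNReal.ofReal r → edge q = edge p ∧ |pos p - pos q| = r := by
      intro q hq
      have h1 := (sideSetoid_of_edist_le hr.le hr'.2.2 hq.le).1
      have h2 := hδ' r hr.le hr'.2.1 q hq.le
      have h3 : edge q = edge p := Prod.ext h2 h1.symm
      refine ⟨h3, (lipschitzWith_pos.abs_sub_le_of_edist_le hr.le hq.le).antisymm ?_⟩
      exact (ENNReal.ofReal_le_ofReal_iff (abs_nonneg _)).1 (hq.symm.trans_le (edist_le h3.symm))
    refine ⟨r, hr, hr'.1, fun q => pos p < pos q, fun q q' hq hq' hP => ?_⟩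
    obtain ⟨h1, h2⟩ := key q hq
    obtain ⟨h3, h4⟩ := key q' hq'
    refine ext (h1.trans h3.symm) ?_
    by_cases h5 : pos p < pos q
    · have h6 := hP.1 h5
      rw [abs_of_neg (by linarith)] at h2 h4
      linarith
    · have h6 : ¬ pos p < pos q' := fun h => h5 (hP.2 h)
      rw [abs_of_nonneg (by linarith)] at h2 h4
      linarith
  · obtain ⟨r, hr, hr'⟩ := exists_between (lt_min hr₀ hp)
    rw [lt_min_iff] at hr'
    have hp' : p = outer (edge p).1 (edge p).2 := ext rfl heq
    have key : ∀ q, edist p q = ENNReal.ofReal r →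
        σ.sideSetoid (edge p) (edge q) ∧ pos q = pos p - r := by
      intro q hq
      have h1 := sideSetoid_of_edist_le hr.le hr'.2 hq.le
      refine ⟨h1, ?_⟩
      have h2 := abs_le.1 (lipschitzWith_pos.abs_sub_le_of_edist_le hr.le hq.le)
      have h3 : pos q ≤ pos p := by
        rw [heq, h1.1]
        exact (pos_mem q).2
      have h4 := edist_outer_le q h1
      rw [← hp', ← heq] at h4
      rw [hq, ENNReal.ofReal_le_ofReal_iff (by linarith)] at h4
      linarith
    refine ⟨r, hr, hr'.1, fun q => (edge p).1 = (edge q).1, fun q q' hq hq' hP => ?_⟩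
    obtain ⟨h1, h2⟩ := key q hq
    obtain ⟨h3, h4⟩ := key q' hq'
    refine ext (Prod.ext ?_ (h1.1.symm.trans h3.1)) (h2.trans h4.symm)
    by_cases h5 : (edge p).1 = (edge q).1
    · exact h5.symm.trans (hP.1 h5)
    · exact (h1.2.resolve_left h5).symm.trans (h3.2.resolve_left fun h => h5 (hP.2 h))

section Equiv

variable (e : PseudoIsometryEquiv (StarPoint σ ℓ hℓ) (StarPoint τ ℓ hℓ))

/-- The position is the distance to the centre of the tile. Centres go to centres, being branch
points, so positions cannot increase; the inverse isometry gives the other inequality. -/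
theorem pos_map (p : StarPoint σ ℓ hℓ) : pos (e.toFun p) = pos p := by
  have key : ∀ {σ τ : Gluing n} (e : PseudoIsometryEquiv (StarPoint σ ℓ hℓ) (StarPoint τ ℓ hℓ))
      (p : StarPoint σ ℓ hℓ), pos (e.toFun p) ≤ pos p := by
    intro σ τ e p
    have h := edist_center_le p 0
    rw [← e.isometry_toFun] at h
    have h' := lipschitzWith_pos.abs_sub_le_of_edist_le (pos_mem p).1 h
    rw [isBranchPoint_iff.1 (e.isometry_toFun.isBranchPoint (isBranchPoint_of_pos_eq_zero rfl)),
      zero_sub, abs_neg] at h'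
    exact (le_abs_self _).trans h'
  refine (key e p).antisymm ?_
  rw [← pos_eq_of_edist_eq_zero (e.left_inv p)]
  exact key e.symm (e.toFun p)

/-- Both points are compared with the outer vertex: its image has position `ℓ s`, and the image of
`p` is within `ℓ s - pos p < ℓ s` of it, too close for a centre to lie between. -/
theorem sideSetoid_map {p q : StarPoint σ ℓ hℓ} (hp : 0 < pos p) (hq : 0 < pos q)
    (h : σ.sideSetoid (edge p) (edge q)) :
    τ.sideSetoid (edge (e.toFun p)) (edge (e.toFun q)) := by
  have key : ∀ p : StarPoint σ ℓ hℓ, 0 < pos p → τ.sideSetoid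
      (edge (e.toFun (outer (edge p).1 (edge p).2))) (edge (e.toFun p)) := by
    intro p hp
    have h1 := edist_outer_le p (Setoid.refl' _ _)
    refine sideSetoid_of_edist_le (sub_nonneg.2 (pos_mem p).2) ?_
      ((e.isometry_toFun _ _).trans_le h1)
    rw [pos_map]
    change _ < ℓ (edge p).2
    linarith
  have h1 : edist (e.toFun (outer (edge p).1 (edge p).2))
      (e.toFun (outer (edge q).1 (edge q).2)) = 0 := by
    rw [e.isometry_toFun]
    exact edist_outer rfl rfl h
  have h2 := sideSetoid_of_edist_eq_zero (by rw [pos_map]; exact hℓ _) h1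
  exact Setoid.trans' _ (Setoid.symm' _ (key p hp)) (Setoid.trans' _ h2 (key q hq))

/-- The outer endpoint keeps its position, so the image edge is at least as long; with the inverse
the lengths agree, and distinct lengths determine the label. -/
theorem side_map (hinj : Function.Injective ℓ) {p : StarPoint σ ℓ hℓ} (hp : 0 < pos p) :
    (edge (e.toFun p)).2 = (edge p).2 := by
  have key : ∀ {σ τ : Gluing n} (e : PseudoIsometryEquiv (StarPoint σ ℓ hℓ) (StarPoint τ ℓ hℓ))
      (p : StarPoint σ ℓ hℓ), 0 < pos p → ℓ (edge p).2 ≤ ℓ (edge (e.toFun p)).2 := by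
    intro σ τ e p hp
    have h := (pos_mem (e.toFun (outer (edge p).1 (edge p).2))).2
    rw [pos_map] at h
    rwa [← (sideSetoid_map e (p := outer (edge p).1 (edge p).2) (hℓ _) hp
      (Setoid.refl' _ _)).1]
  refine hinj (le_antisymm ?_ (key e p hp))
  refine (key e.symm (e.toFun p) (by rwa [pos_map])).trans_eq ?_
  rw [(sideSetoid_of_edist_eq_zero hp ((edist_comm _ _).trans (e.left_inv p))).1]
  rfl

/-- The tile onto whose center an isometry maps the center of a tile. -/
def tileMap (i : Fin n) : Fin n := (edge (e.toFun (center i 0))).1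

theorem pos_map_center (i : Fin n) (s : Fin 3) : pos (e.toFun (center i s)) = 0 := pos_map e _

theorem tileMap_symm_tileMap (i : Fin n) : tileMap e.symm (tileMap e i) = i := by
  have h1 : edist (center (tileMap e i) 0) (e.toFun (center i 0)) = 0 :=
    edist_center rfl (pos_map_center e i 0) rfl
  rw [← e.isometry_invFun] at h1
  have h2 : edist (center i 0) (e.invFun (center (tileMap e i) 0)) = 0 := by
    have := edist_triangle_right (center i 0) (e.invFun (center (tileMap e i) 0))
      (e.invFun (e.toFun (center i 0)))
    rw [h1, edist_comm _ (e.invFun (e.toFun _)), e.left_inv, add_zero] at this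
    exact nonpos_iff_eq_zero.1 this
  obtain ⟨δ, hδ, h⟩ := exists_tile_eq (center i 0 : StarPoint σ ℓ hℓ) (hℓ 0)
  exact h 0 le_rfl hδ _ (h2.trans_le (by simp))

/-- The claim is clear for a point `q` of the same edge close to the centre, whose image stays in
the image tile; it passes from `q` to `p` by `sideSetoid_map`. -/
theorem sideSetoid_tileMap (hinj : Function.Injective ℓ) {p : StarPoint σ ℓ hℓ} (hp : 0 < pos p) :
    τ.sideSetoid (tileMap e (edge p).1, (edge p).2) (edge (e.toFun p)) := by
  obtain ⟨δ, hδ, h⟩ := exists_tile_eq (e.toFun (center (edge p).1 0))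
    (by rw [pos_map_center]; exact hℓ _)
  obtain ⟨x, hx, hx'⟩ := exists_between (lt_min hδ hp)
  rw [lt_min_iff] at hx'
  let q : StarPoint σ ℓ hℓ := mk (edge p).1 (edge p).2 x ⟨hx.le, hx'.2.le.trans (pos_mem p).2⟩
  have h1 := h x hx.le hx'.1 (e.toFun q) ((e.isometry_toFun _ _).trans_le (edist_center_le q 0))
  have h2 : edge (e.toFun q) = (tileMap e (edge p).1, (edge p).2) :=
    Prod.ext h1 (side_map e hinj (p := q) hx)
  rw [← h2]
  exact sideSetoid_map e hx hp (Setoid.refl' _ _)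

theorem tileMap_nbr_of_ne (hinj : Function.Injective ℓ) (s : Fin 3) (i : Fin n)
    (hi : σ.nbr s i ≠ i) : tileMap e (σ.nbr s i) = τ.nbr s (tileMap e i) := by
  have h1 := sideSetoid_tileMap e hinj (p := outer i s) (hℓ s)
  have h2 := sideSetoid_tileMap e hinj (p := outer (σ.nbr s i) s) (hℓ s)
  have h3 := sideSetoid_map e (p := outer i s) (q := outer (σ.nbr s i) s) (hℓ s) (hℓ s)
    ⟨rfl, .inr rfl⟩
  obtain ⟨-, h | h⟩ := Setoid.trans' _ (Setoid.trans' _ h1 h3) (Setoid.symm' _ h2)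
  · have := congrArg (tileMap e.symm) h
    change tileMap e.symm (tileMap e i) = tileMap e.symm (tileMap e (σ.nbr s i)) at this
    rw [tileMap_symm_tileMap, tileMap_symm_tileMap] at this
    exact absurd this.symm hi
  · exact h.symm

theorem tileMap_nbr (hinj : Function.Injective ℓ) (s : Fin 3) (i : Fin n) :
    tileMap e (σ.nbr s i) = τ.nbr s (tileMap e i) := by
  by_cases hi : σ.nbr s i = i
  · rw [hi]
    by_contra hne
    -- If the image tile had a neighbour across side `s`, the inverse would map that neighbour to
    -- `i` as well.
    have h := tileMap_nbr_of_ne e.symm hinj s (tileMap e i) (Ne.symm hne)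
    rw [tileMap_symm_tileMap, hi] at h
    have := tileMap_symm_tileMap e.symm (τ.nbr s (tileMap e i))
    rw [h] at this
    exact hne this
  · exact tileMap_nbr_of_ne e hinj s i hi

end Equiv

end StarPoint

/-- Isometric star graphs with edges of three different lengths come from gluings that agree up to
the numbering of the tiles. -/
theorem exists_perm_of_isometric {n : ℕ} {σ τ : Gluing n} {ℓ : Fin 3 → ℝ} {hℓ : ∀ s, 0 < ℓ s}
    (hinj : Function.Injective ℓ) (h : (σ.starGraph ℓ hℓ).Isometric (τ.starGraph ℓ hℓ)) :
    ∃ π : Equiv.Perm (Fin n), ∀ s i, π (σ.nbr s i) = τ.nbr s (π i) := by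
  obtain ⟨f⟩ := h
  obtain ⟨e⟩ := IsometryEquiv.exists_pseudoIsometryEquiv f
  exact ⟨⟨StarPoint.tileMap e, StarPoint.tileMap e.symm, StarPoint.tileMap_symm_tileMap e,
    StarPoint.tileMap_symm_tileMap e.symm⟩, StarPoint.tileMap_nbr e hinj⟩

end Gluing

/-! ## Transplantation matrices from incidence matrices -/

namespace Gluing

variable {n : ℕ}

/-- The sign attached to a tile by the 2-colouring with colour classes `A` and `Aᶜ`. -/
def colourSign (A : Finset ℕ) (i : Fin n) : ℂ := if (i : ℕ) ∈ A then 1 else -1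

theorem colourSign_mul_self (A : Finset ℕ) (i : Fin n) :
    colourSign A i * colourSign A i = 1 := by
  rw [colourSign]
  split_ifs <;> norm_num

/-- The tiles are properly coloured by membership in `A`. -/
def IsColouring (σ : Gluing n) (A : Finset ℕ) : Prop :=
  ∀ s i, σ.nbr s i ≠ i → ((σ.nbr s i : ℕ) ∈ A ↔ (i : ℕ) ∉ A)

instance (σ : Gluing n) (A : Finset ℕ) : Decidable (σ.IsColouring A) :=
  inferInstanceAs (Decidable (∀ s i, σ.nbr s i ≠ i → ((σ.nbr s i : ℕ) ∈ A ↔ (i : ℕ) ∉ A)))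

/-- Glued tiles have opposite signs, so minus the product is `1`; on a boundary side `j = i` and it
is `-1`. -/
theorem IsColouring.continuation_apply {σ : Gluing n} {A : Finset ℕ} (h : σ.IsColouring A)
    (s : Fin 3) (i j : Fin n) : σ.continuation s i j =
      if j = σ.nbr s i then -(colourSign A i * colourSign A j) else 0 := by
  rw [continuation, Matrix.of_apply]
  by_cases hi : σ.nbr s i = i
  · rw [if_pos hi, hi]
    refine if_ctx_congr Iff.rfl (fun hj => ?_) fun _ => rfl
    rw [hj, colourSign_mul_self]
  · rw [if_neg hi]
    refine if_ctx_congr Iff.rfl (fun hj => ?_) fun _ => rfl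
    rw [hj, colourSign, colourSign]
    by_cases hA : (i : ℕ) ∈ A
    · rw [if_pos hA, if_neg fun h' => (h s i hi).1 h' hA]
      norm_num
    · rw [if_neg hA, if_pos ((h s i hi).2 hA)]
      norm_num

/-- The tile reached from `i` by crossing the sides in the list `w`. -/
def walk (σ : Gluing n) (w : List (Fin 3)) (i : Fin n) : Fin n := w.foldl (fun k s => σ.nbr s k) i

theorem walk_of_perm {σ τ : Gluing n} {π : Equiv.Perm (Fin n)}
    (h : ∀ s i, π (σ.nbr s i) = τ.nbr s (π i)) (w : List (Fin 3)) (i : Fin n) :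
    π (σ.walk w i) = τ.walk w (π i) := by
  induction w generalizing i with
  | nil => rfl
  | cons s w ih =>
    change π (σ.walk w (σ.nbr s i)) = τ.walk w (τ.nbr s (π i))
    rw [ih, h]

/-- The number of tiles to which both walks return. -/
def closedWalks (σ : Gluing n) (w w' : List (Fin 3)) : ℕ :=
  (Finset.univ.filter fun i => σ.walk w i = i ∧ σ.walk w' i = i).card

/-- Two words are needed: for one word the count is the trace of a permutation matrix, and an
invertible incidence matrix intertwining the permutations makes these traces equal. -/
theorem closedWalks_eq_of_perm {σ τ : Gluing n} {π : Equiv.Perm (Fin n)}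
    (h : ∀ s i, π (σ.nbr s i) = τ.nbr s (π i)) (w w' : List (Fin 3)) :
    σ.closedWalks w w' = τ.closedWalks w w' := by
  refine Finset.card_equiv π fun i => ?_
  simp only [Finset.mem_filter, Finset.mem_univ, true_and, ← walk_of_perm h, π.injective.eq_iff]

end Gluing

/-! ### Signed incidence matrices of symmetric designs -/

namespace TilePair

variable (P : TilePair)

/-- The incidence matrix of points and hyperplanes with signs from 2-colourings of the tiles of
both gluings. -/
def signedIncidence (A B : Finset ℕ) : Matrix (Fin P.n) (Fin P.n) ℂ :=
  Matrix.of fun j i =>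
    if j + i ∈ P.blockSet then Gluing.colourSign B j * Gluing.colourSign A i else 0

/-- Combinatorial conditions under which the signed incidence matrix is a transplantation: the
tiles are properly coloured, the involutions of `right` are induced by those of `left`, and the
hyperplanes are the blocks of a symmetric design, `k` of them containing a given point and `l`
containing two given points. -/
structure IsDesign (A B : Finset ℕ) (k l : ℕ) : Prop where
  left : P.left.IsColouring A
  right : P.right.IsColouring B
  invariant : ∀ s j i, P.right.nbr s j + P.left.nbr s i ∈ P.blockSet ↔ j + i ∈ P.blockSet
  card : ∀ i i', (Finset.univ.filter fun j => j + i ∈ P.blockSet ∧ j + i' ∈ P.blockSet).card =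
    if i = i' then k else l
  lt : l < k

instance (A B : Finset ℕ) (k l : ℕ) : Decidable (P.IsDesign A B k l) :=
  decidable_of_iff (P.left.IsColouring A ∧ P.right.IsColouring B ∧
    (∀ s j i, P.right.nbr s j + P.left.nbr s i ∈ P.blockSet ↔ j + i ∈ P.blockSet) ∧
    (∀ i i', (Finset.univ.filter fun j => j + i ∈ P.blockSet ∧ j + i' ∈ P.blockSet).card =
      if i = i' then k else l) ∧ l < k)
    ⟨fun ⟨h1, h2, h3, h4, h5⟩ => ⟨h1, h2, h3, h4, h5⟩,
      fun ⟨h1, h2, h3, h4, h5⟩ => ⟨h1, h2, h3, h4, h5⟩⟩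

variable {P} {A B : Finset ℕ} {k l : ℕ}

theorem IsDesign.intertwines (h : P.IsDesign A B k l) (s : Fin 3) :
    P.signedIncidence A B * P.left.continuation s =
      P.right.continuation s * P.signedIncidence A B := by
  ext j i
  rw [Matrix.mul_apply, Matrix.mul_apply,
    Finset.sum_eq_single (P.left.nbr s i), Finset.sum_eq_single (P.right.nbr s j)]
  · rw [h.left.continuation_apply, h.right.continuation_apply, if_pos rfl,
      if_pos (P.left.invol s i).symm, signedIncidence, Matrix.of_apply, Matrix.of_apply]
    have h1 : j + P.left.nbr s i ∈ P.blockSet ↔ P.right.nbr s j + i ∈ P.blockSet := by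
      rw [← h.invariant s, P.left.invol]
    by_cases h2 : P.right.nbr s j + i ∈ P.blockSet
    · rw [if_pos h2, if_pos (h1.2 h2)]
      -- Each side has one surviving term, equal to `-(sign of j)(sign of i)` times the square of
      -- the sign of a neighbouring tile.
      linear_combination (-Gluing.colourSign B j * Gluing.colourSign A i) *
        (Gluing.colourSign_mul_self A (P.left.nbr s i) -
          Gluing.colourSign_mul_self B (P.right.nbr s j))
    · rw [if_neg h2, if_neg fun h3 => h2 (h1.1 h3), zero_mul, mul_zero]
  · intro j' _ hj'
    rw [h.right.continuation_apply, if_neg hj', zero_mul]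
  · simp
  · intro i' _ hi'
    rw [h.left.continuation_apply, if_neg, mul_zero]
    rintro rfl
    exact hi' (P.left.invol s i').symm
  · simp

theorem IsDesign.transpose_mul_self (h : P.IsDesign A B k l) :
    (P.signedIncidence A B).transpose * P.signedIncidence A B = ((k : ℂ) - l) • 1 +
      (l : ℂ) • Matrix.vecMulVec (Gluing.colourSign A) (Gluing.colourSign A) := by
  ext i i'
  have h1 (j : Fin P.n) : P.signedIncidence A B j i * P.signedIncidence A B j i' =
      (if j + i ∈ P.blockSet ∧ j + i' ∈ P.blockSet then 1 else 0) *
        (Gluing.colourSign A i * Gluing.colourSign A i') := by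
    simp only [signedIncidence, Matrix.of_apply]
    by_cases h1 : j + i ∈ P.blockSet <;> by_cases h2 : j + i' ∈ P.blockSet <;> simp [h1, h2]
    linear_combination (Gluing.colourSign A i * Gluing.colourSign A i') *
      Gluing.colourSign_mul_self B j
  simp only [Matrix.mul_apply, Matrix.transpose_apply, h1]
  rw [← Finset.sum_mul, ← Finset.sum_filter, Finset.sum_const, h.card]
  simp only [Matrix.add_apply, Matrix.smul_apply, Matrix.one_apply, Matrix.vecMulVec_apply,
    nsmul_eq_mul, smul_eq_mul, mul_one]
  split_ifs with hi
  · subst hi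
    rw [Gluing.colourSign_mul_self]
    ring
  · ring

/-- With `E` the rank one matrix of the signs, `E² = n E`, so `(k - l) + l E` has only the
eigenvalues `k - l` and `k - l + l n`, both nonzero. The left inverse below uses the
Sherman–Morrison formula. -/
theorem IsDesign.isUnit (h : P.IsDesign A B k l) : IsUnit (P.signedIncidence A B) := by
  have hkl : (k : ℂ) - l ≠ 0 := sub_ne_zero.2 (Nat.cast_injective.ne h.lt.ne')
  have hkn : (k : ℂ) - l + l * P.n ≠ 0 := by
    have h0 : 0 < k - l + l * P.n := Nat.add_pos_left (Nat.sub_pos_of_lt h.lt) _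
    rw [← Nat.cast_sub h.lt.le]
    exact_mod_cast h0.ne'
  set E : Matrix (Fin P.n) (Fin P.n) ℂ := Matrix.vecMulVec (Gluing.colourSign A) (Gluing.colourSign A) with hE
  have hEE : E * E = (P.n : ℂ) • E := by
    rw [hE, Matrix.vecMulVec_mul_vecMulVec]
    have : Gluing.colourSign A ⬝ᵥ (Gluing.colourSign A : Fin P.n → ℂ) = P.n := by
      simp [dotProduct, Gluing.colourSign_mul_self]
    rw [this, Matrix.vecMulVec_smul]
  have hinv : (((k : ℂ) - l)⁻¹ • (1 - ((l : ℂ) / ((k : ℂ) - l + l * P.n)) • E) *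
      (P.signedIncidence A B).transpose) * P.signedIncidence A B = 1 := by
    rw [Matrix.mul_assoc, h.transpose_mul_self, ← hE]
    simp only [Matrix.smul_mul, Matrix.sub_mul, Matrix.mul_add, Matrix.mul_smul, Matrix.one_mul,
      Matrix.mul_one, hEE]
    match_scalars
    · field_simp
    · field_simp
      ring
  exact IsUnit.of_mul_eq_one_right _ hinv

theorem IsDesign.isTransplantation (h : P.IsDesign A B k l) :
    P.IsTransplantation (P.signedIncidence A B) where
  isUnit := h.isUnit
  intertwines := h.intertwines
  entry_eq j i := by
    refine ⟨fun hji => ?_, fun hji => if_neg hji⟩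
    rw [signedIncidence, Matrix.of_apply, if_pos hji, Gluing.colourSign, Gluing.colourSign]
    split_ifs <;> simp

theorem IsDesign.exists_transplantation (h : P.IsDesign A B k l) (w w' : List (Fin 3))
    (hw : P.left.closedWalks w w' ≠ P.right.closedWalks w w') :
    ∃ T : Matrix (Fin P.n) (Fin P.n) ℂ, P.IsTransplantation T ∧
      ∀ (ℓ : Fin 3 → ℝ) (hℓ : ∀ s, 0 < ℓ s),
        (∀ z : ℂ, Set.BijOn (Gluing.transplant P.left P.right T ℓ hℓ)
          ((P.left.starGraph ℓ hℓ).laplacian.eigenspaceAt z)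
          ((P.right.starGraph ℓ hℓ).laplacian.eigenspaceAt z)) ∧
        (P.left.starGraph ℓ hℓ).Isospectral (P.right.starGraph ℓ hℓ) ∧
        (Function.Injective ℓ →
          ¬ (P.left.starGraph ℓ hℓ).Isometric (P.right.starGraph ℓ hℓ)) := by
  refine ⟨_, h.isTransplantation, fun ℓ hℓ => ?_⟩
  obtain ⟨h1, h2⟩ := Gluing.transplant_bijOn_and_isospectral ℓ hℓ h.isUnit h.intertwines
  refine ⟨h1, h2, fun hinj hiso => ?_⟩
  obtain ⟨π, hπ⟩ := Gluing.exists_perm_of_isometric hinj hiso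
  exact hw (Gluing.closedWalks_eq_of_perm hπ w w')

end TilePair

/-! ### Verification for the seventeen pairs -/

theorem isDesign_pair7_1 : pair7_1.IsDesign
    {0, 3, 5, 6} {0, 3, 5, 6} 3 1 := by
  decide +kernel

theorem isDesign_pair7_2 : pair7_2.IsDesign
    {0, 2, 6} {0, 1, 4, 6} 3 1 := by
  decide +kernel

theorem isDesign_pair7_3 : pair7_3.IsDesign
    {0, 2, 6} {0, 2, 6} 3 1 := by
  decide +kernel

theorem isDesign_pair13_1 : pair13_1.IsDesign
    {0, 1, 3, 4, 7, 8, 11} {0, 2, 5, 6, 7, 9} 4 1 := by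
  decide +kernel

theorem isDesign_pair13_2 : pair13_2.IsDesign
    {0, 3, 4, 5, 6, 12} {0, 1, 3, 4, 8, 10, 11} 4 1 := by
  decide +kernel

theorem isDesign_pair13_3 : pair13_3.IsDesign
    {0, 2, 7, 8, 9, 10, 11} {0, 2, 4, 9, 10, 11, 12} 4 1 := by
  decide +kernel

theorem isDesign_pair13_4 : pair13_4.IsDesign
    {0, 4, 7, 8, 9, 11} {0, 1, 2, 3, 5, 6, 7} 4 1 := by
  decide +kernel

theorem isDesign_pair13_5 : pair13_5.IsDesign
    {0, 1, 2, 7, 8, 9, 10, 11} {0, 1, 2, 3, 5, 6, 7, 12} 4 1 := by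
  decide +kernel

theorem isDesign_pair13_6 : pair13_6.IsDesign
    {0, 2, 7, 8, 9, 10, 11} {0, 2, 4, 9, 10, 11, 12} 4 1 := by
  decide +kernel

theorem isDesign_pair13_7 : pair13_7.IsDesign
    {0, 1, 2, 7, 8, 9, 10, 11} {0, 1, 2, 3, 5, 6, 7, 12} 4 1 := by
  decide +kernel

theorem isDesign_pair13_8 : pair13_8.IsDesign
    {0, 3, 4, 7, 8, 11} {0, 1, 2, 3, 4, 10, 11} 4 1 := by
  decide +kernel

theorem isDesign_pair13_9 : pair13_9.IsDesign
    {0, 1, 3, 4, 7, 11, 12} {0, 4, 7, 8, 9, 10} 4 1 := by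
  decide +kernel

theorem isDesign_pair15_1 : pair15_1.IsDesign
    {0, 2, 4, 6, 7, 10, 12, 14} {0, 2, 8, 9, 11, 13, 14} 7 3 := by
  decide +kernel

theorem isDesign_pair15_2 : pair15_2.IsDesign
    {0, 2, 4, 6, 7, 10, 12, 14} {0, 2, 3, 6, 7, 8, 12} 7 3 := by
  decide +kernel

theorem isDesign_pair15_3 : pair15_3.IsDesign
    {0, 1, 3, 4, 5, 9, 10, 11, 13} {0, 1, 4, 5, 6, 7, 10, 12, 14} 7 3 := by
  decide +kernel

theorem isDesign_pair15_4 : pair15_4.IsDesign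
    {0, 1, 5, 7, 8, 12, 13, 14} {0, 4, 8, 9, 10, 11, 13, 14} 7 3 := by
  decide +kernel

theorem isDesign_pair21_1 : pair21_1.IsDesign
    {0, 1, 4, 5, 6, 9, 13, 15, 16, 19, 20} {0, 1, 5, 6, 7, 8, 11, 13, 15, 20} 5 1 := by
  decide +kernel

theorem mainTheorem3 (P : TilePair) (hP : P ∈ bcdsPairs) :
    ∃ T : Matrix (Fin P.n) (Fin P.n) ℂ, P.IsTransplantation T ∧
      ∀ (ℓ : Fin 3 → ℝ) (hℓ : ∀ s, 0 < ℓ s),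
        (∀ z : ℂ, Set.BijOn (Gluing.transplant P.left P.right T ℓ hℓ)
          ((P.left.starGraph ℓ hℓ).laplacian.eigenspaceAt z)
          ((P.right.starGraph ℓ hℓ).laplacian.eigenspaceAt z)) ∧
        (P.left.starGraph ℓ hℓ).Isospectral (P.right.starGraph ℓ hℓ) ∧
        (Function.Injective ℓ →
          ¬ (P.left.starGraph ℓ hℓ).Isometric (P.right.starGraph ℓ hℓ)) := by
  simp only [bcdsPairs, List.mem_cons, List.not_mem_nil, or_false] at hP
  rcases hP with rfl | rfl | rfl | rfl | rfl | rfl | rfl | rfl | rfl | rfl | rfl | rfl | rfl | rfl |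
    rfl | rfl | rfl
  -- Here the two words act as elations of the Fano plane with the same centre and different axes:
  -- they have one common fixed point but three common fixed lines.
  · exact isDesign_pair7_1.exists_transplantation [2, 0, 2] [0] (by decide +kernel)
  · exact isDesign_pair7_2.exists_transplantation [2, 0, 2] [0] (by decide +kernel)
  · exact isDesign_pair7_3.exists_transplantation [2, 0, 2] [0] (by decide +kernel)
  · exact isDesign_pair13_1.exists_transplantation [1, 0, 1] [0] (by decide +kernel)
  · exact isDesign_pair13_2.exists_transplantation [1, 0, 1] [0] (by decide +kernel)
  · exact isDesign_pair13_3.exists_transplantation [2, 0, 2] [0] (by decide +kernel)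
  · exact isDesign_pair13_4.exists_transplantation [1, 0, 1] [0] (by decide +kernel)
  · exact isDesign_pair13_5.exists_transplantation [1, 0, 1] [0] (by decide +kernel)
  · exact isDesign_pair13_6.exists_transplantation [1, 0, 1] [0] (by decide +kernel)
  · exact isDesign_pair13_7.exists_transplantation [1, 0, 1] [0] (by decide +kernel)
  · exact isDesign_pair13_8.exists_transplantation [2, 0, 2] [0] (by decide +kernel)
  · exact isDesign_pair13_9.exists_transplantation [0, 2, 0] [1, 2] (by decide +kernel)
  · exact isDesign_pair15_1.exists_transplantation [2] [1, 2, 1] (by decide +kernel)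
  · exact isDesign_pair15_2.exists_transplantation [2] [1, 2, 1] (by decide +kernel)
  · exact isDesign_pair15_3.exists_transplantation [2, 0, 2, 1] [0, 1, 0] (by decide +kernel)
  · exact isDesign_pair15_4.exists_transplantation [2] [1, 2, 1] (by decide +kernel)
  · exact isDesign_pair21_1.exists_transplantation [0, 2, 0] [2, 0, 1, 2] (by decide +kernel)
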